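/- **Setting.** Let $\mathcal U$ be a finite set of integer variables, and let $\mathcal F=\mathbb Z^{\mathcal U}$ be the set of stores. For $R\subseteq\mathcal U$ let $\mathcal S(R)=\mathbb Z^R$ be the set of partial stores with domain $R$. A distribution is a function $D:\mathcal F\to[0,\infty)$ with $\sum D:=\sum_{s\in\mathcal F}D(s)<\infty$. For $s\in\mathcal S(R)$ put $D(s)=\sum_{s_0\in\mathcal F,\ s_0|_R=s}D(s_0)$. Disjoint sets $R_1,R_2\subseteq\mathcal U$ are *independent in $D$* if $D(s_1\oplus s_2)\sum D=D(s_1)D(s_2)$ for all $s_1\in\mathcal S(R_1)$, $s_2\in\mathcal S(R_2)$, where $s_1\oplus s_2\in\mathcal S(R_1\cup R_2)$ is the union of $s_1$ and $s_2$. A *probabilistic control-flow graph* (pCFG) is a finite directed graph with node set $\mathcal V$. Each node is either an assignment $x:=E$, a random assignment $x:=\mathrm{Random}(\psi)$ with $\psi$ a probability distribution on $\mathbb Z$, an $\mathrm{Observe}(B)$ node or a $\mathrm{Skip}$ node (these have exactly one outgoing edge), or a branching node with condition $B$ (with a true-successor and a false-successor), or the node $\mathtt{End}$, which has no outgoing edge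 and may carry the label $\mathrm{Return}(x)$. There is a path from a node $\mathtt{Start}$ to every node and a path from every node to $\mathtt{End}$. $\mathrm{Def}(v)$ is the set of variables assigned at $v$ and $\mathrm{Use}(v)$ is the set of variables occurring in the right-hand side, condition or return label of $v$. Variables are defined before use: if $x\in\mathrm{Use}(v)$, every path from $\mathtt{Start}$ to $v$ contains a node $v_0\ne v$ with $x\in\mathrm{Def}(v_0)$. Write $(v,v')\in\mathsf{PD}$ ($v'$ *postdominates* $v$) if $v'$ is on all paths from $v$ to $\mathtt{End}$. For $v\neq\mathtt{End}$, $\mathrm{fppd}(v)$ is the unique $v_1\ne v$ postdominating $v$ such that, for every other $v_2\ne v$ postdominating $v$, all paths from $v$ to $v_2$ contain $v_1$. $\mathrm{LAP}(v,v')$ is the maximal number of edges of an acyclic path from $v$ to $v'$. A node $v$ is *cycle-inducing* if some successor $v_i$ of $v$ satisfies $\mathrm{LAP}(v_i,\mathrm{fppd}(v))\ge\mathrm{LAP}(v,\mathrm{fppd}(v))$. For $(v,v')\in\mathsf{PD}$, $v$ *stays outside $Q$ until $v'$* if every path from $v$ to $v'$ on which $v'$ occurs only at the end contains no node of $Q$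 except possibly $v'$. **Semantics.** Put $\mathrm{select}_B(D)(s)=D(s)$ if $B$ holds in $s$ and $0$ otherwise; $\mathrm{assign}_{x:=E}(D)(s')=\sum_{s:\ s'=s[x\mapsto[\![E]\!]s]}D(s)$; $\mathrm{rassign}_{x:=\psi}(D)(s')=\sum_{s:\ s=s'\text{ off }x}\psi(s'(x))D(s)$. Given $h_0$, which assigns to each pair in $\mathsf{PD}$ a map on distributions, define $h=\mathcal H(h_0)$ of the same kind by recursion on $\mathrm{LAP}(v,v')$: $h(v,v)(D)=D$; if $v'\ne v$ and $v'\neq v''=\mathrm{fppd}(v)$, $h(v,v')(D)=h(v'',v')(h(v,v'')(D))$; if $v'=\mathrm{fppd}(v)$, $h(v,v')(D)$ is $D$, $\mathrm{assign}_{x:=E}(D)$, $\mathrm{rassign}_{x:=\psi}(D)$ or $\mathrm{select}_B(D)$ according to whether $v$ is a skip, an assignment, a random assignment or an observe node, and for a branching node $v$ with condition $B$, true-successor $v_1$ and false-successor $v_2$ it is $D_1'+D_2'$, where $D_1=\mathrm{select}_B(D)$, $D_2=\mathrm{select}_{\neg B}(D)$, and $D_i'=h(v_i,v')(D_i)$ if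 $\mathrm{LAP}(v_i,v')<\mathrm{LAP}(v,v')$ and $D_i'=h_0(v_i,v')(D_i)$ otherwise. The meaning of the pCFG is the least fixed point $\omega=\lim_k\mathcal H^k(0)$ of $\mathcal H$. **Slicing pairs.** For $Q\subseteq\mathcal V$: a node $v_2$ is *data dependent* on $v_1$ if for some $x\in\mathrm{Use}(v_2)\cap\mathrm{Def}(v_1)$ there is a path with at least one edge from $v_1$ to $v_2$ none of whose interior nodes defines $x$. $v'$ is a *next visible* in $Q$ of $v$ if $v'\in Q\cup\{\mathtt{End}\}$ and $v'$ is on all paths from $v$ to nodes of $Q\cup\{\mathtt{End}\}$. $Q$ is a *weak slice set* if every node has a next visible in $Q$ and $v_1\in Q$ whenever some $v_2\in Q$ is data dependent on $v_1$. The set $\mathrm{rv}_Q(v)$ of *$Q$-relevant variables* for $v$ consists of the $x$ for which there are $v'\in Q$ with $x\in\mathrm{Use}(v')$ and an acyclic path from $v$ to $v'$ on which no node other than $v'$ defines $x$. $(Q,Q_0)$ is a *slicing pair* if $Q$ and $Q_0$ are disjoint weak slice sets, $\mathtt{End}\in Q$, all Observe nodes are in $Q\cup Q_0$, and every cycle-inducing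 node $v$ is in $Q\cup Q_0$ or is sum-preserving, i.e. $\sum\omega(v,\mathrm{fppd}(v))(D)=\sum D$ for all distributions $D$. **Proposition.** Let $(Q,Q_0)$ be a slicing pair of a pCFG, let $(v,v')\in\mathsf{PD}$, let $D$ be a distribution with $\sum D<\infty$, and let $D'=\omega(v,v')(D)$. Put $R=\mathrm{rv}_Q(v)$, $R'=\mathrm{rv}_Q(v')$, $R_0=\mathrm{rv}_{Q_0}(v)$, $R_0'=\mathrm{rv}_{Q_0}(v')$. If $R$ and $R_0$ are independent in $D$, then: 1. $R'$ and $R'_0$ are (disjoint and) independent in $D'$; 2. if $v$ stays outside $Q$ until $v'$, then $R'=R$ and $D(s)\sum D'=D'(s)\sum D$ for all $s\in\mathcal S(R)$; 3. if $v$ stays outside $Q_0$ until $v'$, then $R_0'=R_0$ and $D(s_0)\sum D'=D'(s_0)\sum D$ for all $s_0\in\mathcal S(R_0)$. -/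

import Mathlib

open scoped ENNReal

/-- A store: every program variable of the finite universe `U` holds an integer. -/
abbrev Store (U : Type*) := U → ℤ

/-- An integer expression: its free variables, and its value as a function of their values. -/
structure AExp (U : Type*) where
  fv : Set U
  val : (fv → ℤ) → ℤ

/-- A boolean expression: its free variables, and its value as a function of their values. -/
structure BExp (U : Type*) where
  fv : Set U
  val : (fv → ℤ) → Bool

namespace AExp

/-- The value of an expression in a store. -/
def eval {U : Type*} (E : AExp U) (s : Store U) : ℤ := E.val fun x => s x

end AExp

namespace BExp

/-- The value of a boolean expression in a store. -/
def eval {U : Type*} (B : BExp U) (s : Store U) : Bool := B.val fun x => s x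

/-- The negation of a boolean expression. -/
def not {U : Type*} (B : BExp U) : BExp U where
  fv := B.fv
  val := fun s => !(B.val s)

end BExp

/-- The label of a node, together with its successors. `ret` and `halt` have no successor and
are the possible labels of the end node. -/
inductive Instr (V U : Type*) where
  | skip (next : V)
  | assign (x : U) (E : AExp U) (next : V)
  | rassign (x : U) (ψ : PMF ℤ) (next : V)
  | observe (B : BExp U) (next : V)
  | branch (B : BExp U) (ifTrue ifFalse : V)
  | ret (x : U)
  | halt

namespace Instr

variable {V U : Type*}

/-- The set of successors. -/
def succs : Instr V U → Set V
  | skip n => {n}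
  | assign _ _ n => {n}
  | rassign _ _ n => {n}
  | observe _ n => {n}
  | branch _ t f => {t, f}
  | ret _ => ∅
  | halt => ∅

/-- The set of defined variables. -/
def defs : Instr V U → Set U
  | assign x _ _ => {x}
  | rassign x _ _ => {x}
  | _ => ∅

/-- The set of used variables. -/
def uses : Instr V U → Set U
  | assign _ E _ => E.fv
  | observe B _ => B.fv
  | branch B _ _ => B.fv
  | ret x => {x}
  | _ => ∅

/-- Being an `observe` instruction. -/
def IsObserve : Instr V U → Prop
  | observe _ _ => True
  | _ => False

/-- `π` is a path from `v` to `v'` in the graph given by `instr`, as its (nonempty) list of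
nodes, both end points included; `[v]` is the path of length zero from `v` to `v`. -/
def IsPath (instr : V → Instr V U) (v v' : V) (π : List V) : Prop :=
  π.IsChain (fun a b => b ∈ (instr a).succs) ∧ π.head? = some v ∧ π.getLast? = some v'

end Instr

/-- A probabilistic control-flow graph with nodes `V` and variables `U`. -/
structure PCFG (V U : Type*) where
  instr : V → Instr V U
  start : V
  exit : V
  exit_succs : (instr exit).succs = ∅
  exists_path_exit : ∀ v, ∃ π, Instr.IsPath instr v exit π
  exists_path_start : ∀ v, ∃ π, Instr.IsPath instr start v π
  /-- All variables are defined before they are used. -/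
  defined_before_use : ∀ v, ∀ x ∈ (instr v).uses, ∀ π, Instr.IsPath instr start v π →
    ∃ v₀ ∈ π, v₀ ≠ v ∧ x ∈ (instr v₀).defs

namespace PCFG

variable {V U : Type*} (G : PCFG V U)

/-- There is an edge from `a` to `b`. -/
def Edge (a b : V) : Prop := b ∈ (G.instr a).succs

/-- `π` is the list of nodes of a path from `v` to `v'`. -/
def IsPath (v v' : V) (π : List V) : Prop := Instr.IsPath G.instr v v' π

/-- `v₁` postdominates `v`, that is `(v, v₁) ∈ PD`. -/
def PD (v v₁ : V) : Prop := ∀ π, G.IsPath v G.exit π → v₁ ∈ π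

/-- `v₁` is a proper postdominator of `v`. -/
def ProperPD (v v₁ : V) : Prop := G.PD v v₁ ∧ v₁ ≠ v

/-- `v₁` is a first proper postdominator of `v`. -/
def IsFirstPD (v v₁ : V) : Prop :=
  G.ProperPD v v₁ ∧ ∀ v₂, G.ProperPD v v₂ → v₂ ≠ v₁ → ∀ π, G.IsPath v v₂ π → v₁ ∈ π

open Classical in
/-- The first proper postdominator of `v`; it exists and is unique for every `v` other than the
end node, where the value `v` is a default. -/
noncomputable def fppd (v : V) : V :=
  if h : ∃ v₁, G.IsFirstPD v v₁ then h.choose else v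

/-- The maximum length (number of edges) of an acyclic path from `v` to `v'`. -/
noncomputable def LAP (v v' : V) : ℕ :=
  sSup {n | ∃ π, G.IsPath v v' π ∧ π.Nodup ∧ π.length = n + 1}

/-- `v` is cycle-inducing. -/
def CycleInducing (v : V) : Prop :=
  ∃ w, G.Edge v w ∧ G.LAP v (G.fppd v) ≤ G.LAP w (G.fppd v)

/-- `v₂` is data dependent on `v₁`; `π` lists the interior nodes of the path. -/
def DataDep (v₁ v₂ : V) : Prop :=
  ∃ x ∈ (G.instr v₂).uses ∩ (G.instr v₁).defs, ∃ π : List V,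
    G.IsPath v₁ v₂ (v₁ :: (π ++ [v₂])) ∧ ∀ u ∈ π, x ∉ (G.instr u).defs

/-- `Q` is closed under data dependence. -/
def ClosedDataDep (Q : Set V) : Prop := ∀ v₁ v₂, v₂ ∈ Q → G.DataDep v₁ v₂ → v₁ ∈ Q

/-- The set of `Q`-relevant variables for `v`. -/
def rv (Q : Set V) (v : V) : Set U :=
  {x | ∃ v' ∈ Q, x ∈ (G.instr v').uses ∧ ∃ π, G.IsPath v v' π ∧ π.Nodup ∧
    ∀ u ∈ π, u ≠ v' → x ∉ (G.instr u).defs}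

/-- `v` stays outside `Q` until `v'` (used when `v'` postdominates `v`). -/
def StaysOutside (Q : Set V) (v v' : V) : Prop :=
  ∀ π, G.IsPath v v' π → v' ∉ π.dropLast → ∀ u ∈ π, u ∈ Q → u = v'

/-- `v'` is a next visible in `Q` of `v`. -/
def NextVisible (Q : Set V) (v v' : V) : Prop :=
  v' ∈ Q ∪ {G.exit} ∧ ∀ w ∈ Q ∪ {G.exit}, ∀ π, G.IsPath v w π → v' ∈ π

/-- `Q` is a weak slice set: it provides next visibles and is closed under data dependence. -/
structure WeakSliceSet (Q : Set V) : Prop where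
  nextVisible : ∀ v, ∃ v', G.NextVisible Q v v'
  closed : G.ClosedDataDep Q

section Termination

/-! Facts about paths that make the recursion on `LAP` well-founded. -/

variable {G}

theorem IsPath.mem_left {v w : V} {π : List V} (h : G.IsPath v w π) : v ∈ π :=
  List.mem_of_head? h.2.1

theorem IsPath.mem_right {v w : V} {π : List V} (h : G.IsPath v w π) : w ∈ π :=
  List.mem_of_getLast? h.2.2

theorem IsPath.append {u v w : V} {π ρ : List V} (h : G.IsPath u v (π ++ [v]))
    (h' : G.IsPath v w (v :: ρ)) : G.IsPath u w (π ++ v :: ρ) := by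
  obtain ⟨h1, h2, h3⟩ := h
  obtain ⟨k1, k2, k3⟩ := h'
  refine ⟨?_, ?_, ?_⟩
  · rw [List.isChain_append] at h1 ⊢
    refine ⟨h1.1, k1, ?_⟩
    simpa using h1.2.2
  · cases π <;> simpa using h2
  · simpa [List.getLast?_append] using k3

theorem IsPath.split {u v w : V} {π ρ : List V} (h : G.IsPath u w (π ++ v :: ρ)) :
    G.IsPath u v (π ++ [v]) ∧ G.IsPath v w (v :: ρ) := by
  obtain ⟨h1, h2, h3⟩ := h
  rw [List.isChain_append] at h1
  refine ⟨⟨?_, ?_, by simp⟩, ⟨h1.2.1, by simp, ?_⟩⟩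
  · rw [List.isChain_append]
    refine ⟨h1.1, by simp, ?_⟩
    simpa using h1.2.2
  · cases π <;> simpa using h2
  · simpa [List.getLast?_append] using h3

theorem IsPath.eq_cons {v w : V} {π : List V} (h : G.IsPath v w π) : ∃ ρ, π = v :: ρ := by
  obtain ⟨-, h2, -⟩ := h
  cases π with
  | nil => simp at h2
  | cons a l => exact ⟨l, by simpa using h2⟩

theorem IsPath.eq_concat {v w : V} {π : List V} (h : G.IsPath v w π) : ∃ ρ, π = ρ ++ [w] := by
  obtain ⟨-, -, h3⟩ := h
  exact List.getLast?_eq_some_iff.1 h3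

theorem IsPath.exists_nodup {v w : V} {π : List V} (h : G.IsPath v w π) :
    ∃ ρ, G.IsPath v w ρ ∧ ρ.Nodup ∧ ∀ u ∈ ρ, u ∈ π := by
  induction π generalizing v with
  | nil => exact absurd h.mem_left (by simp)
  | cons a l ih =>
    obtain rfl : a = v := by simpa using h.2.1
    cases l with
    | nil => exact ⟨[a], h, by simp, by simp⟩
    | cons b l =>
      have hs : G.IsPath b w (b :: l) := (IsPath.split (π := [a]) h).2
      obtain ⟨ρ, hρ, hn, hsub⟩ := ih hs
      by_cases ha : a ∈ ρ
      · obtain ⟨ρ₁, ρ₂, rfl⟩ := List.append_of_mem ha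
        refine ⟨a :: ρ₂, hρ.split.2, (List.nodup_append.1 hn).2.1, ?_⟩
        intro u hu
        exact List.mem_cons_of_mem _ (hsub u (by simp at hu ⊢; tauto))
      · obtain ⟨ρ', rfl⟩ := hρ.eq_cons
        refine ⟨a :: b :: ρ', ?_, List.nodup_cons.2 ⟨ha, hn⟩, ?_⟩
        · have hab : G.IsPath a b ([a] ++ [b]) := (IsPath.split (π := [a]) h).1
          exact IsPath.append hab hρ
        · intro u hu
          rcases List.mem_cons.1 hu with rfl | hu
          · simp
          · exact List.mem_cons_of_mem _ (hsub u hu)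

/-- A node other than the end node has a first proper postdominator. -/
theorem exists_isFirstPD {v : V} (hv : v ≠ G.exit) : ∃ v₁, G.IsFirstPD v v₁ := by
  classical
  obtain ⟨π, hπ⟩ := G.exists_path_exit v
  obtain ⟨ρ, hρ, hn, -⟩ := IsPath.exists_nodup (G := G) hπ
  obtain ⟨v₁, h₁, hmin⟩ : ∃ v₁, G.ProperPD v v₁ ∧
      ∀ v₂, G.ProperPD v v₂ → ρ.idxOf v₁ ≤ ρ.idxOf v₂ := by
    have hex : ∃ n, ∃ u, G.ProperPD v u ∧ ρ.idxOf u = n :=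
      ⟨_, G.exit, ⟨fun π h => h.mem_right, hv.symm⟩, rfl⟩
    obtain ⟨u, hu, hu'⟩ := Nat.find_spec hex
    exact ⟨u, hu, fun v₂ h₂ => hu' ▸ Nat.find_min' hex ⟨v₂, h₂, rfl⟩⟩
  refine ⟨v₁, h₁, fun v₂ h₂ hne σ hσ => ?_⟩
  by_contra hmem
  obtain ⟨ρ₁, ρ₂, rfl⟩ := List.append_of_mem (h₂.1 ρ hρ)
  obtain ⟨σ', rfl⟩ := hσ.eq_concat
  have hcat := IsPath.append hσ hρ.split.2
  have h3 := h₁.1 _ hcat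
  have h4 : v₁ ∈ ρ₂ := by
    simp only [List.mem_append, List.mem_cons, List.not_mem_nil, or_false] at h3 hmem
    tauto
  have h5 := hmin v₂ h₂
  have h6 : v₁ ∉ ρ₁ := fun h => (List.nodup_append.1 hn).2.2 _ h _ (by simp [h4]) rfl
  have h7 : v₂ ∉ ρ₁ := fun h => (List.nodup_append.1 hn).2.2 _ h _ (by simp) rfl
  rw [List.idxOf_append_of_notMem h6, List.idxOf_append_of_notMem h7,
    List.idxOf_cons_ne _ hne, List.idxOf_cons_self] at h5
  omega

theorem isFirstPD_fppd {v : V} (hv : v ≠ G.exit) : G.IsFirstPD v (G.fppd v) := by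
  have h := exists_isFirstPD (G := G) hv
  rw [fppd, dif_pos h]
  exact h.choose_spec

theorem PD.exists_path {v w : V} (h : G.PD v w) : ∃ π, G.IsPath v w π := by
  obtain ⟨π, hπ⟩ := G.exists_path_exit v
  obtain ⟨ρ₁, ρ₂, rfl⟩ := List.append_of_mem (h π hπ)
  exact ⟨_, (IsPath.split (G := G) hπ).1⟩

theorem PD.ne_exit {v w : V} (h : G.PD v w) (hne : v ≠ w) : v ≠ G.exit := by
  rintro rfl
  have hm := h [G.exit] ⟨by simp, by simp, by simp⟩
  exact hne (by simpa using hm : w = G.exit).symm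

/-- The first proper postdominator comes before every other postdominator. -/
theorem PD.fppd_left {v w : V} (h : G.PD v w) (hne : v ≠ w) : G.PD (G.fppd v) w := by
  by_cases hw : w = G.fppd v
  · subst hw; exact fun π hπ => hπ.mem_left
  intro σ hσ
  by_contra hmem
  obtain ⟨π, hπ⟩ := G.exists_path_exit v
  have hwπ := h π hπ
  obtain ⟨π₁, π₂, rfl, hw₁⟩ := List.eq_append_cons_of_mem hwπ
  have hp := (IsPath.split (G := G) hπ).1
  have hf := (isFirstPD_fppd (h.ne_exit hne)).2 w ⟨h, hne.symm⟩ hw _ hp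
  have hf' : G.fppd v ∈ π₁ := by simpa [Ne.symm hw] using hf
  obtain ⟨τ₁, τ₂, rfl⟩ := List.append_of_mem hf'
  obtain ⟨σ', rfl⟩ := hσ.eq_cons
  have hq : G.IsPath v (G.fppd v) (τ₁ ++ [G.fppd v]) := by
    rw [List.append_assoc, List.cons_append] at hp
    exact hp.split.1
  have := h _ (hq.append hσ)
  simp only [List.mem_append, List.mem_cons] at this hmem hw₁
  tauto

theorem PD.antisymm {v w : V} (h : G.PD v w) (h' : G.PD w v) : v = w := by
  by_contra hne
  obtain ⟨π, hπ⟩ := G.exists_path_exit v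
  obtain ⟨ρ, hρ, hn, -⟩ := IsPath.exists_nodup (G := G) hπ
  obtain ⟨ρ', rfl⟩ := hρ.eq_cons
  have hw : w ∈ ρ' := by simpa [Ne.symm hne] using h _ hρ
  obtain ⟨ρ₁, ρ₂, rfl⟩ := List.append_of_mem hw
  have h1 := h' _ (IsPath.split (π := v :: ρ₁) hρ).2
  have h2 := (List.nodup_cons.1 hn).1
  simp only [List.mem_append, List.mem_cons] at h1 h2
  tauto

theorem lap_bddAbove [Finite V] (v w : V) :
    BddAbove {n | ∃ π, G.IsPath v w π ∧ π.Nodup ∧ π.length = n + 1} := by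
  classical
  have := Fintype.ofFinite V
  refine ⟨Fintype.card V, ?_⟩
  rintro n ⟨π, -, hn, hl⟩
  have := hn.length_le_card
  omega

theorem lap_spec [Finite V] {v w : V} (h : ∃ π, G.IsPath v w π) :
    ∃ π, G.IsPath v w π ∧ π.Nodup ∧ π.length = G.LAP v w + 1 := by
  obtain ⟨π, hπ⟩ := h
  obtain ⟨ρ, hρ, hn, -⟩ := hπ.exists_nodup
  have hne : {n | ∃ π, G.IsPath v w π ∧ π.Nodup ∧ π.length = n + 1}.Nonempty := by
    obtain ⟨ρ', rfl⟩ := hρ.eq_cons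
    exact ⟨ρ'.length, _, hρ, hn, by simp⟩
  exact Nat.sSup_mem hne (lap_bddAbove v w)

theorem lap_add_le [Finite V] {u v w : V} (h : G.PD u v) (h' : G.PD v w) (hne : v ≠ w) :
    G.LAP u v + G.LAP v w ≤ G.LAP u w := by
  obtain ⟨π, hπ, hn, hl⟩ := lap_spec h.exists_path
  obtain ⟨ρ, hρ, hn', hl'⟩ := lap_spec h'.exists_path
  obtain ⟨π, rfl⟩ := hπ.eq_concat
  obtain ⟨ρ, rfl⟩ := hρ.eq_cons
  refine le_csSup (lap_bddAbove u w) ⟨π ++ v :: ρ, hπ.append hρ, ?_, by simp at hl hl' ⊢; omega⟩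
  have hvπ : v ∉ π := fun hv => (List.nodup_append.1 hn).2.2 _ hv _ (by simp) rfl
  refine List.nodup_append.2 ⟨(List.nodup_append.1 hn).1, hn', ?_⟩
  rintro a ha b hb rfl
  have hav : a ≠ v := by rintro rfl; exact hvπ ha
  have haρ : a ∈ ρ := by simpa [hav] using hb
  obtain ⟨σ, hσ, hvσ⟩ : ∃ σ, G.IsPath w G.exit σ ∧ v ∉ σ := by
    by_contra hcon
    push Not at hcon
    exact hne (h'.antisymm hcon)
  obtain ⟨π₁, π₂, rfl⟩ := List.append_of_mem ha
  obtain ⟨ρ₁, ρ₂, rfl⟩ := List.append_of_mem haρ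
  have p1 : G.IsPath u a (π₁ ++ [a]) := by
    rw [List.append_assoc, List.cons_append] at hπ
    exact hπ.split.1
  have p2 : G.IsPath a w (a :: ρ₂) := (IsPath.split (π := v :: ρ₁) hρ).2
  have p12 := p1.append p2
  obtain ⟨τ, hτ⟩ := p12.eq_concat
  obtain ⟨σ, rfl⟩ := hσ.eq_cons
  have hv1 : v ∉ π₁ ++ a :: ρ₂ := by
    have h2 := (List.nodup_cons.1 hn').1
    simp only [List.mem_append, List.mem_cons] at h2 hvπ ⊢
    tauto
  have p3 := h _ ((hτ ▸ p12).append hσ)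
  rw [hτ] at hv1
  simp only [List.mem_append, List.mem_cons, List.not_mem_nil, or_false] at p3 hv1 hvσ
  tauto

theorem lap_pos [Finite V] {v w : V} (h : ∃ π, G.IsPath v w π) (hne : v ≠ w) :
    0 < G.LAP v w := by
  obtain ⟨π, hπ, -, hl⟩ := lap_spec h
  by_contra h0
  obtain ⟨ρ, rfl⟩ := hπ.eq_cons
  obtain rfl : ρ = [] := List.eq_nil_of_length_eq_zero (by simp at hl; omega)
  exact hne (by simpa using hπ.2.2)

/-- The decrease of `LAP` in the two recursive calls along the first proper postdominator. -/
theorem lap_fppd_lt [Finite V] {v w : V} (h : G.PD v w) (hne : v ≠ w) (hw : w ≠ G.fppd v) :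
    G.LAP v (G.fppd v) < G.LAP v w ∧ G.LAP (G.fppd v) w < G.LAP v w := by
  have hf := (isFirstPD_fppd (h.ne_exit hne)).1
  have hg := h.fppd_left hne
  have h1 := lap_add_le hf.1 hg hw.symm
  have h2 := lap_pos hf.1.exists_path hf.2.symm
  have h3 := lap_pos hg.exists_path hw.symm
  omega

end Termination

end PCFG

/-- Distributions: weights on the stores. Extended weights make all sums and suprema below
meaningful without side conditions; the distributions of interest have finite mass. -/
abbrev Distr (U : Type*) := Store U → ℝ≥0∞

namespace Distr

variable {U : Type*}

/-- The sum of all weights. -/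
noncomputable def mass (D : Distr U) : ℝ≥0∞ := ∑' s, D s

open Classical in
/-- The weight of a partial store `s` with domain `R`: the sum of the weights of the stores that
agree with `s` on `R`. -/
noncomputable def marg (D : Distr U) {R : Set U} (s : R → ℤ) : ℝ≥0∞ :=
  ∑' s₀ : Store U, if ∀ x : R, s₀ x = s x then D s₀ else 0

open Classical in
/-- The union of two partial stores with disjoint domains. -/
noncomputable def join {R₁ R₂ : Set U} (s₁ : R₁ → ℤ) (s₂ : R₂ → ℤ) : ↑(R₁ ∪ R₂) → ℤ :=
  fun x => if h : x.1 ∈ R₁ then s₁ ⟨x.1, h⟩ else s₂ ⟨x.1, x.2.resolve_left h⟩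

/-- The disjoint sets of variables `R₁` and `R₂` are independent in `D`. -/
def Independent (D : Distr U) (R₁ R₂ : Set U) : Prop :=
  ∀ (s₁ : R₁ → ℤ) (s₂ : R₂ → ℤ),
    D.marg (join s₁ s₂) * D.mass = D.marg s₁ * D.marg s₂

/-- Keep the weight of the stores that satisfy `B`. -/
noncomputable def select (B : BExp U) (D : Distr U) : Distr U :=
  fun s => if B.eval s = true then D s else 0

open Classical in
/-- The effect of the assignment `x := E`. -/
noncomputable def assign (x : U) (E : AExp U) (D : Distr U) : Distr U :=
  fun s' => ∑' s : Store U, if s' = Function.update s x (E.eval s) then D s else 0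

open Classical in
/-- The effect of the random assignment of a value drawn from `ψ` to `x`. -/
noncomputable def rassign (x : U) (ψ : PMF ℤ) (D : Distr U) : Distr U :=
  fun s' => ∑' s : Store U, if ∀ y, y ≠ x → s' y = s y then ψ (s' x) * D s else 0

/-- A transformer of distributions preserves the mass. -/
def SumPreserving (f : Distr U → Distr U) : Prop :=
  ∀ D : Distr U, D.mass ≠ ∞ → (f D).mass = D.mass

end Distr

namespace PCFG

variable {V U : Type*} (G : PCFG V U)

open Classical in
/-- The functional `H_X` on modification functions, by recursion on `LAP v v'`. A modification
function is only meaningful at pairs with `PD v v'`; elsewhere the value 0 is a default. -/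
noncomputable def HH [Finite V] (X : Set V) (h₀ : V → V → Distr U → Distr U) (v v' : V) :
    Distr U → Distr U :=
  if hPD : G.PD v v' then
    if hv : v' = v then fun D => D
    else if hf : v' = G.fppd v then
      if v ∈ X then
        match G.instr v with
        | .assign x E _ => fun D => D.assign x E
        | .rassign x ψ _ => fun D => D.rassign x ψ
        | .observe B _ => fun D => D.select B
        | .branch B v₁ v₂ => fun D =>
          (if h : G.LAP v₁ v' < G.LAP v v' then HH X h₀ v₁ v' (D.select B)
            else h₀ v₁ v' (D.select B)) +
          (if h : G.LAP v₂ v' < G.LAP v v' then HH X h₀ v₂ v' (D.select B.not)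
            else h₀ v₂ v' (D.select B.not))
        | _ => fun D => D
      else fun D => D
    else fun D => HH X h₀ (G.fppd v) v' (HH X h₀ v (G.fppd v) D)
  else fun _ => 0
termination_by G.LAP v v'
decreasing_by
  · exact h
  · exact h
  · exact (lap_fppd_lt hPD (Ne.symm hv) hf).2
  · exact (lap_fppd_lt hPD (Ne.symm hv) hf).1

/-- The `k`-th iterate of `H_X` from the modification function 0. -/
noncomputable def iter [Finite V] (X : Set V) (k : ℕ) : V → V → Distr U → Distr U :=
  (G.HH X)^[k] (fun _ _ _ => 0)

/-- The least fixed point of `H_X`, as the limit of the increasing chain of its iterates. -/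
noncomputable def fixed [Finite V] (X : Set V) : V → V → Distr U → Distr U :=
  fun v v' D s => ⨆ k, G.iter X k v v' D s

/-- The meaning of the program: `G.ω v v'` is the modification of distributions as control moves
from `v` to `v'`. -/
noncomputable def ω [Finite V] : V → V → Distr U → Distr U := G.fixed Set.univ

/-- `(Q, Q₀)` is a slicing pair. -/
structure SlicingPair [Finite V] (Q Q₀ : Set V) : Prop where
  weak : G.WeakSliceSet Q
  weak₀ : G.WeakSliceSet Q₀
  exit_mem : G.exit ∈ Q
  disjoint : Disjoint Q Q₀
  observe_mem : ∀ v, (G.instr v).IsObserve → v ∈ Q ∪ Q₀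
  cycleInducing : ∀ v, G.CycleInducing v →
    v ∈ Q ∪ Q₀ ∨ Distr.SumPreserving (G.ω v (G.fppd v))

end PCFG

/-! A distribution is tested against functions `φ` of the store. Its marginal on `R` amounts to its
integrals over all `φ` that depend only on `R`, and `Distr.LEOn R` compares two distributions
through these.

A way that avoids a slice set `Q` defines no variable that is `Q`-relevant at its end: the last such
definition would be in `Q` by closure under data dependence. So the relevant set does not change
(`ClosedDataDep.rv_eq`), the weights seen by it cannot grow (`ω_leOn`), and a factor depending on it
commutes with `ω` (`ω_mul`).

The core is `SymmSlicingPair.iter_leOn_ω`: on a way that avoids `Q₀`, the marginal on the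
`Q`-relevant variables at the end depends only, and monotonically, on that at the start. A node of
`Q` reads only relevant variables. At a node outside `Q`, everything up to its first proper
postdominator is outside both slice sets, so mass is preserved (`mass_ω_eq`); weights that do not
grow while their total is kept are unchanged.

Independence then enters through a change of density. For `φ₂` depending on the `Q₀`-relevant
variables, it says that `D` weighted by `mass D * φ₂` and `D` weighted by the constant `∫ φ₂ dD`
have the same marginal on the `Q`-relevant variables. Both are pushed through `ω` on a way outside
`Q₀`; the results agree on the `Q`-relevant variables at the end, and pulling the weights out of `ω`
gives `integ_ω_mul`. Taking `φ₁ = 1` gives the third claim, and the second by exchanging the slice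
sets. Combining the two identities gives independence at the end of such a way. Since `Q` and `Q₀`
are disjoint, each node is outside one of them, and so is its way to its first proper postdominator;
independence thus propagates from postdominator to postdominator. -/

namespace PCFG

/-! ### Paths, postdominators and relevant variables -/

section Paths

variable {V U : Type*} {G : PCFG V U}

theorem isPath_singleton (v : V) : G.IsPath v v [v] := ⟨by simp, by simp, by simp⟩

theorem IsPath.cons {u v w : V} {π : List V} (h : G.Edge u v) (hπ : G.IsPath v w π) :
    G.IsPath u w (u :: π) := by
  have huv : G.IsPath u v ([u] ++ [v]) := ⟨by simpa using show v ∈ (G.instr u).succs from h, by simp, by simp⟩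
  obtain ⟨ρ, rfl⟩ := hπ.eq_cons
  exact huv.append hπ

theorem IsPath.exists_first {u v w : V} {π : List V} (h : G.IsPath v w π) (hu : u ∈ π) :
    ∃ ρ τ, π = ρ ++ u :: τ ∧ u ∉ ρ ∧ G.IsPath v u (ρ ++ [u]) := by
  obtain ⟨ρ, τ, rfl, hn⟩ := List.eq_append_cons_of_mem hu
  exact ⟨ρ, τ, rfl, hn, h.split.1⟩

theorem IsPath.exists_edge {v w : V} {π : List V} (h : G.IsPath v w π) (hne : v ≠ w) :
    ∃ u, G.Edge v u := by
  obtain ⟨ρ, rfl⟩ := h.eq_cons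
  cases ρ with
  | nil => exact absurd (by simpa using h.2.2) hne
  | cons b l => exact ⟨b, by have := h.1; simp only [List.isChain_cons_cons] at this; exact this.1⟩

theorem PD.of_edge {u v w : V} (h : G.PD v w) (hne : v ≠ w) (he : G.Edge v u) : G.PD u w := by
  intro π hπ
  simpa [hne.symm] using h _ (hπ.cons he)

theorem PD.of_isPath {u v w : V} {π : List V} (h : G.PD v w) (hπ : G.IsPath v u π)
    (hw : w ∉ π) : G.PD u w := by
  intro σ hσ
  obtain ⟨π, rfl⟩ := hπ.eq_concat
  obtain ⟨σ, rfl⟩ := hσ.eq_cons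
  have := h _ (hπ.append hσ)
  simp only [List.mem_append, List.mem_cons] at this hw ⊢
  tauto

theorem PD.exists_path_first {v w : V} (h : G.PD v w) : ∃ ρ, G.IsPath v w (ρ ++ [w]) ∧ w ∉ ρ := by
  obtain ⟨π, hπ⟩ := h.exists_path
  obtain ⟨ρ, τ, -, hn, hρ⟩ := hπ.exists_first hπ.mem_right
  exact ⟨ρ, hρ, hn⟩

theorem fppd_mem {v w : V} {π : List V} (h : G.PD v w) (hne : v ≠ w) (hπ : G.IsPath v w π) :
    G.fppd v ∈ π := by
  by_cases hw : w = G.fppd v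
  · exact hw ▸ hπ.mem_right
  · exact (isFirstPD_fppd (h.ne_exit hne)).2 w ⟨h, hne.symm⟩ hw π hπ

theorem pd_fppd {v : V} (hv : v ≠ G.exit) : G.PD v (G.fppd v) := (isFirstPD_fppd hv).1.1

theorem ne_fppd {v : V} (hv : v ≠ G.exit) : v ≠ G.fppd v := (isFirstPD_fppd hv).1.2.symm

theorem ne_exit_of_edge {v w : V} (h : G.Edge v w) : v ≠ G.exit := by
  rintro rfl
  rw [Edge, G.exit_succs] at h
  exact h

theorem exists_edge_of_ne_exit {v : V} (hv : v ≠ G.exit) : ∃ w, G.Edge v w := by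
  obtain ⟨π, hπ⟩ := G.exists_path_exit v
  exact IsPath.exists_edge (G := G) hπ hv

/-- The sole successor is on every path to the end node, so it is a proper postdominator unless it
is `v`; the first one must then lie on the one-edge path to it. -/
theorem fppd_eq_of_succs {v w : V} (h : (G.instr v).succs = {w}) : G.fppd v = w := by
  have he : ∀ u, G.Edge v u ↔ u = w := fun u => by rw [Edge, h, Set.mem_singleton_iff]
  have hv := ne_exit_of_edge ((he w).2 rfl)
  have hpd : G.PD v w := by
    intro π hπ
    obtain ⟨ρ, rfl⟩ := hπ.eq_cons
    cases ρ with
    | nil => exact absurd (by simpa using hπ.2.2) hv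
    | cons b l =>
      have := hπ.1
      simp only [List.isChain_cons_cons] at this
      simp [(he b).1 this.1]
  have hne : v ≠ w := by
    -- With a self-loop as its only edge, `v` could reach no other node, in particular not `fppd v`.
    rintro rfl
    have hf : ∀ π, G.IsPath v (G.fppd v) π → G.fppd v = v := by
      intro π
      induction π with
      | nil => exact fun h => absurd h.mem_left (by simp)
      | cons a l ih =>
        intro hπ
        obtain rfl : a = v := by simpa using hπ.2.1
        cases l with
        | nil => simpa [eq_comm] using hπ.2.2
        | cons b l =>
          have := hπ.1
          simp only [List.isChain_cons_cons] at this
          obtain rfl := (he b).1 this.1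
          exact ih (IsPath.split (π := [b]) hπ).2
    obtain ⟨π, hπ⟩ := (pd_fppd hv).exists_path
    exact ne_fppd hv (hf π hπ).symm
  have := fppd_mem hpd hne ((isPath_singleton w).cons ((he w).2 rfl))
  simpa [(ne_fppd hv).symm] using this

/-- `p` holds at every node that can be reached from `v` without visiting `v'`. -/
def Along (G : PCFG V U) (v v' : V) (p : V → Prop) : Prop :=
  ∀ u π, G.IsPath v u π → v' ∉ π → p u

namespace Along

variable {v v' w : V} {p : V → Prop}

theorem self (h : G.Along v v' p) (hne : v ≠ v') : p v :=
  h v [v] (isPath_singleton v) (by simpa using hne.symm)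

theorem of_edge (h : G.Along v v' p) (hne : v ≠ v') (he : G.Edge v w) : G.Along w v' p :=
  fun u π hπ hn => h u (v :: π) (hπ.cons he) (by simp [hne.symm, hn])

theorem of_isPath {u : V} {π : List V} (h : G.Along v v' p) (hπ : G.IsPath v u π)
    (hn : v' ∉ π) : G.Along u v' p := by
  intro w σ hσ hn'
  obtain ⟨π, rfl⟩ := hπ.eq_concat
  obtain ⟨σ, rfl⟩ := hσ.eq_cons
  refine h w _ (hπ.append hσ) ?_
  simp only [List.mem_append, List.mem_cons] at hn hn' ⊢
  tauto

theorem of_mem {u : V} {ρ : List V} (h : G.Along v v' p) (hρ : G.IsPath v v' (ρ ++ [v']))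
    (hn : v' ∉ ρ) (hu : u ∈ ρ) : p u := by
  obtain ⟨ρ₁, ρ₂, rfl⟩ := List.append_of_mem hu
  rw [List.append_assoc, List.cons_append] at hρ
  refine h u _ hρ.split.1 ?_
  simp only [List.mem_append, List.mem_cons, List.not_mem_nil, or_false] at hn ⊢
  tauto

/-- A path from `v` that reaches `v'` has already met `fppd v`, so avoiding `fppd v` implies
avoiding `v'`. -/
theorem fppd_left (h : G.Along v v' p) (hpd : G.PD v v') (hne : v ≠ v') :
    G.Along v (G.fppd v) p := by
  intro u π hπ hn
  refine h u π hπ fun hv' => hn ?_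
  obtain ⟨ρ, τ, rfl, -, hρ⟩ := hπ.exists_first hv'
  have := fppd_mem hpd hne hρ
  simp only [List.mem_append, List.mem_cons, List.not_mem_nil, or_false] at this ⊢
  tauto

theorem fppd_right (h : G.Along v v' p) (hpd : G.PD v v') (hne : v ≠ v')
    (hf : v' ≠ G.fppd v) : G.Along (G.fppd v) v' p := by
  obtain ⟨ρ, hρ, hn⟩ := (pd_fppd (hpd.ne_exit hne)).exists_path_first
  refine h.of_isPath hρ fun hv' => hn ?_
  have hv' : v' ∈ ρ := by simpa [hf] using hv'
  obtain ⟨ρ₁, ρ₂, rfl⟩ := List.append_of_mem hv'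
  rw [List.append_assoc, List.cons_append] at hρ
  have := fppd_mem hpd hne hρ.split.1
  simp only [List.mem_append, List.mem_cons, List.not_mem_nil, or_false, hf.symm] at this ⊢
  tauto

end Along

/-- Any path from `v` avoiding `v'` can be prolonged until its first visit to `v'`, because `v'`
postdominates its end. -/
theorem StaysOutside.along {Q : Set V} {v v' : V} (h : G.StaysOutside Q v v')
    (hpd : G.PD v v') : G.Along v v' (· ∉ Q) := by
  intro u π hπ hn huQ
  obtain ⟨ρ, hρ, hn'⟩ := (hpd.of_isPath hπ hn).exists_path_first
  obtain ⟨π, rfl⟩ := hπ.eq_concat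
  obtain ⟨σ, hσ⟩ := hρ.eq_cons
  have hcat := hπ.append (hσ ▸ hρ)
  rw [← hσ, ← List.append_assoc] at hcat
  have hu : u ∈ π ++ ρ ++ [v'] := by rw [List.append_assoc, hσ]; simp
  have hn2 : v' ∉ π ++ ρ := by
    simp only [List.mem_append, List.mem_cons, List.not_mem_nil, or_false] at hn ⊢
    tauto
  have := h _ hcat (by rwa [List.dropLast_concat]) u hu huQ
  subst this
  simp at hn

/-- The end node counts as visible, so the next visible of `v` postdominates `v`; it differs from
`v` because `v` is not visible. Every path from `v` to `Q` meets it, hence meets `fppd v` no later.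
-/
theorem WeakSliceSet.along {Q : Set V} (hQ : G.WeakSliceSet Q) {v : V} (hv : v ≠ G.exit)
    (hvQ : v ∉ Q) : G.Along v (G.fppd v) (· ∉ Q) := by
  obtain ⟨u, hu, hmem⟩ := hQ.nextVisible v
  have hne : v ≠ u := by
    rintro rfl
    exact hu.elim hvQ hv
  have hpd : G.PD v u := fun π hπ => hmem _ (Or.inr rfl) π hπ
  intro w π hπ hn hw
  obtain ⟨ρ, τ, rfl, -, hρ⟩ := hπ.exists_first (hmem w (Or.inl hw) π hπ)
  have := fppd_mem hpd hne hρ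
  simp only [List.mem_append, List.mem_cons, List.not_mem_nil, or_false] at this hn
  tauto

/-! ### Relevant variables and data dependence -/

theorem exists_last_def {x : U} {ρ : List V} (h : ∃ w ∈ ρ, x ∈ (G.instr w).defs) :
    ∃ ρ₁ w ρ₂, ρ = ρ₁ ++ w :: ρ₂ ∧ x ∈ (G.instr w).defs ∧
      ∀ y ∈ ρ₂, x ∉ (G.instr y).defs := by
  induction ρ with
  | nil => simp at h
  | cons a l ih =>
    by_cases hl : ∃ w ∈ l, x ∈ (G.instr w).defs
    · obtain ⟨ρ₁, w, ρ₂, rfl, h1, h2⟩ := ih hl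
      exact ⟨a :: ρ₁, w, ρ₂, rfl, h1, h2⟩
    · push Not at hl
      obtain ⟨w, hw, hx⟩ := h
      rcases List.mem_cons.1 hw with rfl | hw
      · exact ⟨[], w, l, rfl, hx, hl⟩
      · exact absurd hx (hl w hw)

/-- The witnessing path need not be acyclic, since removing cycles adds no node. -/
theorem mem_rv_of_isPath {Q : Set V} {v u : V} {x : U} {π : List V} (hu : u ∈ Q)
    (hx : x ∈ (G.instr u).uses) (hπ : G.IsPath v u π)
    (hd : ∀ w ∈ π, w ≠ u → x ∉ (G.instr w).defs) : x ∈ G.rv Q v := by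
  obtain ⟨ρ, hρ, hn, hsub⟩ := hπ.exists_nodup
  exact ⟨u, hu, hx, ρ, hρ, hn, fun w hw => hd w (hsub w hw)⟩

theorem exists_isPath_of_mem_rv {Q : Set V} {v : V} {x : U} (h : x ∈ G.rv Q v) :
    ∃ u ∈ Q, x ∈ (G.instr u).uses ∧ ∃ σ, G.IsPath v u (σ ++ [u]) ∧
      ∀ w ∈ σ, x ∉ (G.instr w).defs := by
  obtain ⟨u, hu, hx, π, hπ, hn, hd⟩ := h
  obtain ⟨σ, rfl⟩ := hπ.eq_concat
  refine ⟨u, hu, hx, σ, hπ, fun w hw => hd w (by simp [hw]) ?_⟩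
  rintro rfl
  exact (List.nodup_append.1 hn).2.2 _ hw _ (by simp) rfl

theorem uses_subset_rv {Q : Set V} {v : V} (hv : v ∈ Q) : (G.instr v).uses ⊆ G.rv Q v :=
  fun _ hx => mem_rv_of_isPath hv hx (isPath_singleton v) (by simp)

theorem rv_subset_of_edge {Q : Set V} {v w : V} (h : G.Edge v w) :
    G.rv Q w ⊆ G.rv Q v ∪ (G.instr v).defs := by
  intro x hx
  by_cases hd : x ∈ (G.instr v).defs
  · exact Or.inr hd
  obtain ⟨u, hu, hxu, σ, hσ, hn⟩ := exists_isPath_of_mem_rv hx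
  refine Or.inl (mem_rv_of_isPath hu hxu (hσ.cons h) ?_)
  intro y hy hyu
  simp only [List.mem_append, List.mem_cons, List.not_mem_nil, or_false, hyu] at hy
  rcases hy with rfl | hy
  · exact hd
  · exact hn y hy

/-- A definition of `x` that reaches a node of `Q` where `x` is relevant belongs to `Q`. -/
theorem ClosedDataDep.mem_of_last_def {Q : Set V} (hQ : G.ClosedDataDep Q) {a v w : V} {x : U}
    {ρ₁ ρ₂ : List V} (hx : x ∈ G.rv Q v) (hρ : G.IsPath a v (ρ₁ ++ w :: ρ₂ ++ [v]))
    (hw : x ∈ (G.instr w).defs) (hn : ∀ y ∈ ρ₂, x ∉ (G.instr y).defs) : w ∈ Q := by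
  obtain ⟨u, hu, hxu, σ, hσ, hd⟩ := exists_isPath_of_mem_rv hx
  rw [List.append_assoc, List.cons_append] at hρ
  obtain ⟨τ, hτ⟩ := hσ.eq_cons
  have hcat := IsPath.append (π := w :: ρ₂) hρ.split.2 (hτ ▸ hσ)
  rw [← hτ] at hcat
  refine hQ w u hu ⟨x, ⟨hxu, hw⟩, ρ₂ ++ σ, by simpa using hcat, ?_⟩
  intro y hy
  rcases List.mem_append.1 hy with hy | hy
  · exact hn y hy
  · exact hd y hy

/-- If a variable relevant at `v'` were defined on the way, its last definition before `v'` would be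
in `Q`. -/
theorem ClosedDataDep.along_notMem_defs {Q : Set V} (hQ : G.ClosedDataDep Q) {v v' : V}
    (hpd : G.PD v v') (h : G.Along v v' (· ∉ Q)) :
    G.Along v v' fun u => Disjoint (G.rv Q v') (G.instr u).defs := by
  intro u π hπ hn
  rw [Set.disjoint_left]
  intro x hx hxu
  obtain ⟨ρ, hρ, hn'⟩ := (hpd.of_isPath hπ hn).exists_path_first
  have hne : v' ≠ u := by
    rintro rfl
    exact hn hπ.mem_right
  have hu : u ∈ ρ := by simpa [hne.symm] using hρ.mem_left
  obtain ⟨ρ₁, w, ρ₂, rfl, hw, hd⟩ := exists_last_def ⟨u, hu, hxu⟩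
  exact (h.of_isPath hπ hn).of_mem hρ hn' (by simp) (hQ.mem_of_last_def hx hρ hw hd)

/-- A use in `Q` seen from `v'` is seen from `v` because nothing relevant is defined in between; a
path from `v` to a use in `Q` has to pass `v'`. -/
theorem ClosedDataDep.rv_eq {Q : Set V} (hQ : G.ClosedDataDep Q) {v v' : V}
    (hpd : G.PD v v') (h : G.Along v v' (· ∉ Q)) : G.rv Q v' = G.rv Q v := by
  apply Set.Subset.antisymm
  · intro x hx
    obtain ⟨ρ, hρ, hn⟩ := hpd.exists_path_first
    have hd : ∀ u ∈ ρ, x ∉ (G.instr u).defs := fun u hu =>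
      Set.disjoint_left.1 ((hQ.along_notMem_defs hpd h).of_mem hρ hn hu) hx
    obtain ⟨u, hu, hxu, σ, hσ, hd'⟩ := exists_isPath_of_mem_rv hx
    obtain ⟨τ, hτ⟩ := hσ.eq_cons
    have hcat := hρ.append (hτ ▸ hσ)
    rw [← hτ] at hcat
    refine mem_rv_of_isPath hu hxu hcat fun w hw hwu => ?_
    simp only [List.mem_append, List.mem_cons, List.not_mem_nil, or_false, hwu] at hw
    exact hw.elim (hd w) (hd' w)
  · intro x hx
    obtain ⟨u, hu, hxu, π, hπ, -, hd⟩ := hx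
    have hv' : v' ∈ π := by
      by_contra hn
      exact h u π hπ hn hu
    obtain ⟨ρ, τ, rfl, -, -⟩ := hπ.exists_first hv'
    refine mem_rv_of_isPath hu hxu hπ.split.2 fun w hw => hd w (by simp at hw ⊢; tauto)

/-- A variable relevant for both sets is defined on the way from the start node to `v`; the last
such definition would belong to both slice sets. -/
theorem disjoint_rv {Q Q₀ : Set V} (hQ : G.ClosedDataDep Q) (hQ₀ : G.ClosedDataDep Q₀)
    (hdis : Disjoint Q Q₀) (v : V) : Disjoint (G.rv Q v) (G.rv Q₀ v) := by
  rw [Set.disjoint_left]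
  intro x hx hx₀
  obtain ⟨π, hπ⟩ := G.exists_path_start v
  change G.IsPath _ _ _ at hπ
  obtain ⟨ρ, rfl⟩ := hπ.eq_concat
  obtain ⟨u, hu, hxu, σ, hσ, hd⟩ := exists_isPath_of_mem_rv hx
  -- Definition before use, applied at `u`, gives a definition that cannot lie on the
  -- definition-free part `σ` after `v`.
  have hex : ∃ w ∈ ρ, x ∈ (G.instr w).defs := by
    obtain ⟨τ, hτ⟩ := hσ.eq_cons
    have hcat := hπ.append (hτ ▸ hσ)
    rw [← hτ] at hcat
    obtain ⟨w, hw, hwu, hxw⟩ := G.defined_before_use u x hxu _ hcat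
    simp only [List.mem_append, List.mem_cons, List.not_mem_nil, or_false, hwu] at hw
    exact ⟨w, hw.resolve_right fun h => hd w h hxw, hxw⟩
  obtain ⟨ρ₁, w, ρ₂, rfl, hw, hd'⟩ := exists_last_def hex
  exact Set.disjoint_left.1 hdis (hQ.mem_of_last_def hx hπ hw hd')
    (hQ₀.mem_of_last_def hx₀ hπ hw hd')

end Paths

end PCFG

/-! ### Distributions as functionals on test functions -/

theorem ENNReal.tsum_iSup_of_monotone {α : Type*} {f : ℕ → α → ℝ≥0∞} (hf : Monotone f) :
    ∑' a, ⨆ n, f n a = ⨆ n, ∑' a, f n a := by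
  simp_rw [ENNReal.tsum_eq_iSup_sum]
  rw [iSup_comm]
  exact iSup_congr fun s => ENNReal.finsetSum_iSup_of_monotone fun a _ _ h => hf h a

namespace Distr

variable {U : Type*}

/-- The integral of `φ` with respect to the weights `D`. -/
noncomputable def integ (D : Distr U) (φ : Store U → ℝ≥0∞) : ℝ≥0∞ := ∑' s, D s * φ s

open Classical in
/-- The indicator function of the stores that agree with a partial store. -/
noncomputable def agree {R : Set U} (t : R → ℤ) : Store U → ℝ≥0∞ :=
  fun s => if ∀ x : R, s x = t x then 1 else 0

/-- `D₁` has at most the weights of `D₂` as far as the variables in `R` can tell. -/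
def LEOn (R : Set U) (D₁ D₂ : Distr U) : Prop :=
  ∀ φ : Store U → ℝ≥0∞, DependsOn φ R → D₁.integ φ ≤ D₂.integ φ

theorem agree_dependsOn {R : Set U} (t : R → ℤ) : DependsOn (agree t) R := by
  intro s s' h
  have : (∀ x : R, s x = t x) ↔ ∀ x : R, s' x = t x :=
    forall_congr' fun x => by rw [h x x.2]
  unfold agree
  by_cases h' : ∀ x : R, s' x = t x
  · rw [if_pos h', if_pos (this.2 h')]
  · rw [if_neg h', if_neg fun h => h' (this.1 h)]

theorem agree_le_one {R : Set U} (t : R → ℤ) : agree t ≤ 1 := by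
  intro s
  rw [agree]
  split_ifs <;> simp

theorem marg_eq_integ (D : Distr U) {R : Set U} (t : R → ℤ) : D.marg t = D.integ (agree t) := by
  simp [marg, integ, agree]

theorem mass_eq_integ (D : Distr U) : D.mass = D.integ 1 := by simp [mass, integ]

theorem integ_mono {D₁ D₂ : Distr U} {φ₁ φ₂ : Store U → ℝ≥0∞} (hD : D₁ ≤ D₂) (hφ : φ₁ ≤ φ₂) :
    D₁.integ φ₁ ≤ D₂.integ φ₂ :=
  ENNReal.tsum_le_tsum fun s => mul_le_mul' (hD s) (hφ s)

theorem integ_le_mass (D : Distr U) {φ : Store U → ℝ≥0∞} (hφ : φ ≤ 1) : D.integ φ ≤ D.mass :=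
  D.mass_eq_integ ▸ integ_mono le_rfl hφ

theorem integ_zero (φ : Store U → ℝ≥0∞) : (0 : Distr U).integ φ = 0 := by simp [integ]

theorem integ_add (D₁ D₂ : Distr U) (φ : Store U → ℝ≥0∞) :
    (D₁ + D₂).integ φ = D₁.integ φ + D₂.integ φ := by
  simp [integ, add_mul, ENNReal.tsum_add]

theorem integ_mul (D χ φ : Store U → ℝ≥0∞) : integ (D * χ) φ = integ D (χ * φ) := by
  simp [integ, mul_assoc]

theorem integ_const_mul (D φ : Store U → ℝ≥0∞) (c : ℝ≥0∞) :
    integ D ((fun _ => c) * φ) = c * integ D φ := by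
  simp [integ, ← ENNReal.tsum_mul_left, mul_left_comm]

theorem integ_iSup {D : ℕ → Distr U} (hD : Monotone D) (φ : Store U → ℝ≥0∞) :
    integ (fun s => ⨆ n, D n s) φ = ⨆ n, (D n).integ φ := by
  simp_rw [integ, ENNReal.iSup_mul]
  exact ENNReal.tsum_iSup_of_monotone fun m n h s => mul_le_mul_left (hD h s) _

open Classical in
theorem integ_single (D : Distr U) (s : Store U) : D.integ (Pi.single s 1) = D s := by
  rw [integ, tsum_eq_single s fun s' h => by simp [h]]
  simp

/-- One `ψ` serves all `D`, so relations between marginals carry over to all test functions on `R`.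
The value 0 given to variables off `R` is immaterial to `φ`. -/
theorem exists_integ_eq_tsum_marg {R : Set U} {φ : Store U → ℝ≥0∞}
    (hφ : DependsOn φ R) : ∃ ψ : (R → ℤ) → ℝ≥0∞, ∀ D : Distr U,
      D.integ φ = ∑' t : R → ℤ, D.marg t * ψ t := by
  classical
  refine ⟨fun t => φ fun x => if h : x ∈ R then t ⟨x, h⟩ else 0, fun D => ?_⟩
  simp_rw [marg_eq_integ, integ, ← ENNReal.tsum_mul_right]
  rw [ENNReal.tsum_comm]
  refine tsum_congr fun s => ?_
  rw [tsum_eq_single fun x : R => s x]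
  · have : agree (fun x : R => s x) s = 1 := by simp [agree]
    rw [this, mul_one]
    congr 1
    exact hφ fun x hx => by simp [hx]
  · intro t ht
    have : agree t s = 0 := by
      rw [agree, if_neg]
      exact fun h => ht (funext fun x => (h x).symm)
    simp [this]

theorem leOn_of_marg_le {R : Set U} {D₁ D₂ : Distr U}
    (h : ∀ t : R → ℤ, D₁.marg t ≤ D₂.marg t) : LEOn R D₁ D₂ := by
  intro φ hφ
  obtain ⟨ψ, hψ⟩ := exists_integ_eq_tsum_marg hφ
  rw [hψ, hψ]
  exact ENNReal.tsum_le_tsum fun t => mul_le_mul_left (h t) _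

theorem mass_eq_tsum_marg (D : Distr U) (R : Set U) : D.mass = ∑' t : R → ℤ, D.marg t := by
  classical
  simp_rw [marg_eq_integ, integ, mass]
  rw [ENNReal.tsum_comm]
  refine tsum_congr fun s => ?_
  rw [ENNReal.tsum_mul_left, tsum_eq_single fun x : R => s x]
  · simp [agree]
  · intro t ht
    rw [agree, if_neg]
    exact fun h => ht (funext fun x => (h x).symm)

theorem LEOn.trans {R : Set U} {D₁ D₂ D₃ : Distr U} (h : LEOn R D₁ D₂) (h' : LEOn R D₂ D₃) :
    LEOn R D₁ D₃ := fun φ hφ => (h φ hφ).trans (h' φ hφ)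

theorem LEOn.mass_le {R : Set U} {D₁ D₂ : Distr U} (h : LEOn R D₁ D₂) : D₁.mass ≤ D₂.mass := by
  rw [mass_eq_integ, mass_eq_integ]
  exact h 1 fun _ _ _ => rfl

/-- The comparison is an equivalence when the masses are equal and finite. -/
theorem LEOn.symm_of_mass_eq {R : Set U} {D₁ D₂ : Distr U} (h : LEOn R D₁ D₂)
    (hm : D₁.mass = D₂.mass) (hfin : D₁.mass ≠ ∞) : LEOn R D₂ D₁ := by
  have hle : ∀ t : R → ℤ, D₁.marg t ≤ D₂.marg t := fun t => by
    rw [marg_eq_integ, marg_eq_integ]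
    exact h _ (agree_dependsOn t)
  refine leOn_of_marg_le fun t => ?_
  by_contra hlt
  rw [mass_eq_tsum_marg D₁ R] at hm hfin
  rw [mass_eq_tsum_marg D₂ R] at hm
  -- One strict inequality among the marginals would make the finite total masses differ.
  exact (ENNReal.tsum_lt_tsum hfin hle (not_le.1 hlt)).ne hm

theorem select_add_select_not (B : BExp U) (D : Distr U) : D.select B + D.select B.not = D := by
  funext s
  have : B.not.eval s = !(B.eval s) := rfl
  cases h : B.eval s <;> simp [select, this, h]

theorem select_mul (B : BExp U) (D χ : Store U → ℝ≥0∞) :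
    select B (D * χ) = select B D * χ := by
  funext s
  simp [select]

theorem select_mono {B : BExp U} {D₁ D₂ : Distr U} (h : D₁ ≤ D₂) : D₁.select B ≤ D₂.select B := by
  intro s
  simp only [select]
  split_ifs
  exacts [h s, le_rfl]

theorem select_iSup (B : BExp U) (D : ℕ → Distr U) :
    select B (fun s => ⨆ n, D n s) = fun s => ⨆ n, (D n).select B s := by
  funext s
  by_cases h : B.eval s = true <;> simp [select, h]

theorem integ_select (B : BExp U) (D : Distr U) (φ : Store U → ℝ≥0∞) :
    (D.select B).integ φ = D.integ fun s => if B.eval s = true then φ s else 0 := by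
  simp [integ, select]

theorem _root_.BExp.eval_congr {B : BExp U} {s s' : Store U} (h : ∀ x ∈ B.fv, s x = s' x) :
    B.eval s = B.eval s' :=
  congrArg B.val (funext fun x => h x x.2)

theorem LEOn.select {R R' : Set U} {D₁ D₂ : Distr U} {B : BExp U} (h : LEOn R D₁ D₂)
    (hR : R' ⊆ R) (hB : B.fv ⊆ R) : LEOn R' (D₁.select B) (D₂.select B) := by
  intro φ hφ
  rw [integ_select, integ_select]
  refine h _ fun s s' hs => ?_
  rw [BExp.eval_congr fun x hx => hs x (hB hx), hφ fun x hx => hs x (hR hx)]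

theorem integ_assign (x : U) (E : AExp U) (D : Distr U) (φ : Store U → ℝ≥0∞) :
    letI := Classical.decEq U
    (D.assign x E).integ φ = D.integ fun s => φ (Function.update s x (E.eval s)) := by
  classical
  simp_rw [integ, assign, ← ENNReal.tsum_mul_right]
  rw [ENNReal.tsum_comm]
  refine tsum_congr fun s => ?_
  rw [tsum_eq_single (Function.update s x (E.eval s)) fun s' h => by
    rw [if_neg (fun h' => h (by convert h')), zero_mul]]
  rw [if_pos (by congr)]

theorem integ_rassign (x : U) (ψ : PMF ℤ) (D : Distr U) (φ : Store U → ℝ≥0∞) :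
    letI := Classical.decEq U
    (D.rassign x ψ).integ φ = D.integ fun s => ∑' n, ψ n * φ (Function.update s x n) := by
  let := Classical.decEq U
  classical
  simp_rw [integ, rassign, ← ENNReal.tsum_mul_right]
  rw [ENNReal.tsum_comm]
  refine tsum_congr fun s => ?_
  -- The stores that agree with `s` off `x` are parametrized by their value at `x`.
  rw [← ENNReal.tsum_mul_left, ← (Function.update_injective s x).tsum_eq]
  · refine tsum_congr fun n => ?_
    rw [if_pos fun y hy => Function.update_of_ne hy _ _, Function.update_self]
    ring
  · intro s' hs'
    refine ⟨s' x, ?_⟩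
    have h : ∀ y, y ≠ x → s' y = s y := by
      by_contra h
      rw [Function.mem_support, if_neg h, zero_mul] at hs'
      exact hs' rfl
    funext y
    by_cases hy : y = x
    · subst hy; simp
    · simp [hy, h y hy]

end Distr

/-! ### Single instructions and their dual action -/

namespace Instr

variable {V U : Type*}

/-- Being a branching node. -/
def IsBranch : Instr V U → Prop
  | branch _ _ _ => True
  | _ => False

/-- The transformation of distributions at an instruction that is not a branch. -/
noncomputable def basic : Instr V U → Distr U → Distr U
  | assign x E _ => fun D => D.assign x E
  | rassign x ψ _ => fun D => D.rassign x ψ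
  | observe B _ => fun D => D.select B
  | _ => fun D => D

open Classical in
/-- The transformation of functions on stores that is dual to `basic`. -/
noncomputable def pre : Instr V U → (Store U → ℝ≥0∞) → Store U → ℝ≥0∞
  | assign x E _ => fun φ s => φ (Function.update s x (E.eval s))
  | rassign x ψ _ => fun φ s => ∑' n, ψ n * φ (Function.update s x n)
  | observe B _ => fun φ s => if B.eval s = true then φ s else 0
  | _ => fun φ => φ

variable {i : Instr V U}

theorem integ_basic (i : Instr V U) (D : Distr U) (φ : Store U → ℝ≥0∞) :
    (i.basic D).integ φ = D.integ (i.pre φ) := by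
  cases i with
  | assign x E _ =>
    refine (Distr.integ_assign x E D φ).trans ?_
    simp only [pre]
  | rassign x ψ _ =>
    refine (Distr.integ_rassign x ψ D φ).trans ?_
    simp only [pre]
  | observe B _ => exact Distr.integ_select B D φ
  | _ => rfl

theorem pre_mul {R : Set U} {χ : Store U → ℝ≥0∞} (hχ : DependsOn χ R)
    (hR : Disjoint R i.defs) (φ : Store U → ℝ≥0∞) : i.pre (χ * φ) = χ * i.pre φ := by
  classical
  have hupd : ∀ (s : Store U) x n, x ∉ R → χ (Function.update s x n) = χ s := by
    intro s x n hx
    refine hχ fun y hy => Function.update_of_ne ?_ _ _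
    rintro rfl
    exact hx hy
  funext s
  cases i with
  | assign x E _ =>
    have hx : x ∉ R := fun h => Set.disjoint_left.1 hR h rfl
    simp only [pre, Pi.mul_apply]
    congr 1
    convert hupd s x _ hx
  | rassign x ψ _ =>
    have hx : x ∉ R := fun h => Set.disjoint_left.1 hR h rfl
    simp only [pre, Pi.mul_apply, ← ENNReal.tsum_mul_left]
    refine tsum_congr fun n => ?_
    rw [← hupd s x n hx, mul_left_comm]
  | observe B _ => simp [pre]
  | _ => rfl

theorem pre_one_le (i : Instr V U) : i.pre 1 ≤ 1 := by
  intro s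
  cases i with
  | rassign x ψ _ => simp [pre]
  | observe B _ =>
    simp only [pre]
    split_ifs <;> simp
  | _ => simp [pre]

theorem pre_one (hi : ¬ i.IsObserve) : i.pre 1 = 1 := by
  funext s
  cases i with
  | observe B _ => exact absurd trivial hi
  | _ => simp [pre]

/-- Before the instruction, `φ` is determined by its own variables, apart from the one assigned, and
by those the instruction reads. -/
theorem pre_dependsOn {R R' : Set U} {φ : Store U → ℝ≥0∞} (hφ : DependsOn φ R')
    (hR : R' ⊆ R ∪ i.defs) (hu : i.uses ⊆ R) (hi : ¬ i.IsBranch) : DependsOn (i.pre φ) R := by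
  classical
  have hupd : ∀ (s s' : Store U) x n, (∀ y ∈ R, s y = s' y) → R' ⊆ R ∪ {x} →
      φ (Function.update s x n) = φ (Function.update s' x n) := by
    intro s s' x n h hR
    refine hφ fun y hy => ?_
    by_cases hyx : y = x
    · subst hyx; simp
    · simpa [hyx] using h y ((hR hy).resolve_right hyx)
  intro s s' h
  cases i with
  | assign x E _ =>
    have hE : E.eval s = E.eval s' := congrArg E.val (funext fun x => h x (hu x.2))
    simp only [pre, hE]
    convert hupd s s' x _ h hR
  | rassign x ψ _ =>
    simp only [pre]
    refine tsum_congr fun n => ?_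
    congr 1
    convert hupd s s' x _ h hR
  | observe B _ =>
    simp only [pre]
    rw [BExp.eval_congr fun x hx => h x (hu hx), hφ fun x hx => h x ((hR hx).resolve_right id)]
  | branch B _ _ => exact absurd trivial hi
  | _ => exact hφ fun x hx => h x ((hR hx).resolve_right id)

theorem basic_apply [DecidableEq (Store U)] (i : Instr V U) (D : Distr U) (s : Store U) :
    i.basic D s = D.integ (i.pre (Pi.single s 1)) := by
  rw [← integ_basic]
  convert (Distr.integ_single (i.basic D) s).symm

theorem basic_mono {D₁ D₂ : Distr U} (h : D₁ ≤ D₂) : i.basic D₁ ≤ i.basic D₂ := by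
  classical
  intro s
  rw [basic_apply, basic_apply]
  exact Distr.integ_mono h le_rfl

theorem basic_iSup {D : ℕ → Distr U} (hD : Monotone D) :
    i.basic (fun s => ⨆ n, D n s) = fun s => ⨆ n, i.basic (D n) s := by
  classical
  funext s
  simp_rw [basic_apply]
  exact Distr.integ_iSup hD _

theorem basic_mul {R : Set U} {χ : Store U → ℝ≥0∞} (hχ : DependsOn χ R)
    (hR : Disjoint R i.defs) (D : Store U → ℝ≥0∞) : i.basic (D * χ) = i.basic D * χ := by
  classical
  funext s
  rw [Pi.mul_apply, basic_apply, basic_apply, Distr.integ_mul, ← pre_mul hχ hR]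
  -- Against a point mass, `χ` is a constant, which depends on no variables and so passes through
  -- any instruction.
  have : χ * Pi.single s 1 = (fun _ => χ s) * Pi.single s 1 := by
    funext s'
    by_cases h : s' = s
    · subst h; simp
    · simp [h]
  rw [this, pre_mul (R := ∅) (fun _ _ _ => rfl) (by simp), Distr.integ_const_mul, mul_comm]

theorem integ_basic_le {R : Set U} {φ : Store U → ℝ≥0∞} (hφ : DependsOn φ R)
    (hR : Disjoint R i.defs) (D : Distr U) : (i.basic D).integ φ ≤ D.integ φ := by
  rw [integ_basic]
  refine Distr.integ_mono le_rfl ?_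
  have := pre_mul hφ hR 1
  rw [mul_one] at this
  rw [this]
  intro s
  exact mul_le_of_le_one_right' (pre_one_le i s)

theorem mass_basic (hi : ¬ i.IsObserve) (D : Distr U) : (i.basic D).mass = D.mass := by
  rw [Distr.mass_eq_integ, Distr.mass_eq_integ, integ_basic, pre_one hi]

end Instr

namespace PCFG

/-! ### Successors of a node -/

section Edges

variable {V U : Type*} {G : PCFG V U}

open Classical in
/-- The index of the iterate used for the successor `w` of the branching node `v` in the iterate
of index `k + 1`. -/
noncomputable def level (G : PCFG V U) (v w : V) (k : ℕ) : ℕ :=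
  if G.LAP w (G.fppd v) < G.LAP v (G.fppd v) then k + 1 else k

theorem level_succ (v w : V) (k : ℕ) : G.level v w (k + 1) = G.level v w k + 1 := by
  unfold level
  split_ifs <;> rfl

theorem pd_self (v : V) : G.PD v v := fun _ h => IsPath.mem_left (G := G) h

theorem edge_left {v v₁ v₂ : V} {B : BExp U} (h : G.instr v = .branch B v₁ v₂) : G.Edge v v₁ := by
  rw [Edge, h]; simp [Instr.succs]

theorem edge_right {v v₁ v₂ : V} {B : BExp U} (h : G.instr v = .branch B v₁ v₂) :
    G.Edge v v₂ := by
  rw [Edge, h]; simp [Instr.succs]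

theorem pd_fppd_of_edge {v w : V} (h : G.Edge v w) : G.PD w (G.fppd v) :=
  (pd_fppd (ne_exit_of_edge h)).of_edge (ne_fppd (ne_exit_of_edge h)) h

theorem rv_subset_of_isBranch {Q : Set V} {v w : V} (hb : (G.instr v).IsBranch) (hw : G.Edge v w) :
    G.rv Q w ⊆ G.rv Q v := by
  refine (rv_subset_of_edge hw).trans (Set.union_subset le_rfl ?_)
  cases hi : G.instr v with
  | branch B _ _ => exact Set.empty_subset _
  | _ => rw [hi] at hb; exact hb.elim

theorem basic_leOn {Q : Set V} {v : V} (hv : v ≠ G.exit) (hb : ¬ (G.instr v).IsBranch)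
    (hvQ : v ∈ Q) {D₁ D₂ : Distr U} (hle : Distr.LEOn (G.rv Q v) D₁ D₂) :
    Distr.LEOn (G.rv Q (G.fppd v)) ((G.instr v).basic D₁) ((G.instr v).basic D₂) := by
  intro φ hφ
  rw [Instr.integ_basic, Instr.integ_basic]
  refine hle _ (Instr.pre_dependsOn hφ ?_ (uses_subset_rv hvQ) hb)
  obtain ⟨w, hw⟩ := exists_edge_of_ne_exit hv
  have hs : (G.instr v).succs = {w} := by
    rw [Edge] at hw
    cases hi : G.instr v with
    | branch B _ _ => rw [hi] at hb; exact absurd trivial hb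
    | _ => rw [hi] at hw; cases hw <;> rfl
  rw [fppd_eq_of_succs hs]
  exact rv_subset_of_edge hw

end Edges

/-! ### The iterates of the semantic functional -/

section Semantics

variable {V U : Type*} [Finite V] {G : PCFG V U}

theorem iter_zero (v v' : V) (D : Distr U) : G.iter Set.univ 0 v v' D = 0 := rfl

theorem iter_succ (k : ℕ) :
    G.iter (U := U) Set.univ (k + 1) = G.HH Set.univ (G.iter Set.univ k) :=
  Function.iterate_succ_apply' _ _ _

theorem iter_self (k : ℕ) (v : V) (D : Distr U) : G.iter Set.univ (k + 1) v v D = D := by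
  rw [iter_succ, HH, dif_pos (pd_self v), dif_pos rfl]

theorem iter_comp {v v' : V} (h : G.PD v v') (hne : v ≠ v') (hf : v' ≠ G.fppd v) (k : ℕ)
    (D : Distr U) : G.iter Set.univ (k + 1) v v' D =
      G.iter Set.univ (k + 1) (G.fppd v) v' (G.iter Set.univ (k + 1) v (G.fppd v) D) := by
  rw [iter_succ, HH, dif_pos h, dif_neg hne.symm, dif_neg hf]

theorem iter_basic {v : V} (hv : v ≠ G.exit) (hb : ¬ (G.instr v).IsBranch) (k : ℕ)
    (D : Distr U) : G.iter Set.univ (k + 1) v (G.fppd v) D = (G.instr v).basic D := by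
  rw [iter_succ, HH, dif_pos (pd_fppd hv), dif_neg (ne_fppd hv).symm, dif_pos rfl,
    if_pos (Set.mem_univ v)]
  cases h : G.instr v with
  | branch B v₁ v₂ => exact absurd (by rw [h]; trivial) hb
  | _ => rfl

theorem iter_branch {v v₁ v₂ : V} {B : BExp U} (h : G.instr v = .branch B v₁ v₂) (k : ℕ)
    (D : Distr U) : G.iter Set.univ (k + 1) v (G.fppd v) D =
      G.iter Set.univ (G.level v v₁ k) v₁ (G.fppd v) (D.select B) +
      G.iter Set.univ (G.level v v₂ k) v₂ (G.fppd v) (D.select B.not) := by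
  have hv : v ≠ G.exit := ne_exit_of_edge (edge_left h)
  rw [iter_succ, HH, dif_pos (pd_fppd hv), dif_neg (ne_fppd hv).symm, dif_pos rfl,
    if_pos (Set.mem_univ v), h]
  dsimp only
  unfold level
  split_ifs <;> simp only [iter_succ]

/-- This follows the recursion of `HH`: an outer induction on the iterate and an inner one on `LAP`.
A branch successor with smaller `LAP` stays at index `k + 1`; any other drops to `k`. -/
theorem iter_induction {P : ℕ → V → V → Prop} (zero : ∀ v v', P 0 v v')
    (self : ∀ k v, P (k + 1) v v)
    (comp : ∀ k v v', G.PD v v' → v ≠ v' → v' ≠ G.fppd v → P (k + 1) v (G.fppd v) →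
      P (k + 1) (G.fppd v) v' → P (k + 1) v v')
    (basic : ∀ k v, v ≠ G.exit → ¬ (G.instr v).IsBranch → P (k + 1) v (G.fppd v))
    (branch : ∀ k v B v₁ v₂, G.instr v = .branch B v₁ v₂ →
      P (G.level v v₁ k) v₁ (G.fppd v) → P (G.level v v₂ k) v₂ (G.fppd v) →
      P (k + 1) v (G.fppd v)) (k : ℕ) :
    ∀ v v', G.PD v v' → P k v v' := by
  induction k with
  | zero => exact fun v v' _ => zero v v'
  | succ k ih =>
    intro v v' h
    induction hn : G.LAP v v' using Nat.strong_induction_on generalizing v v' with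
    | _ n ihn =>
      subst hn
      by_cases hne : v = v'
      · exact hne ▸ self k v
      by_cases hf : v' = G.fppd v
      · subst hf
        have hv := h.ne_exit hne
        by_cases hb : (G.instr v).IsBranch
        · cases hi : G.instr v with
          | branch B v₁ v₂ =>
            have key : ∀ w, G.Edge v w → P (G.level v w k) w (G.fppd v) := by
              intro w hw
              unfold level
              split_ifs with hlt
              · exact ihn _ hlt w _ (pd_fppd_of_edge hw) rfl
              · exact ih w _ (pd_fppd_of_edge hw)
            exact branch k v B v₁ v₂ hi (key _ (edge_left hi)) (key _ (edge_right hi))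
          | _ => rw [hi] at hb; exact hb.elim
        · exact basic k v hv hb
      · obtain ⟨h1, h2⟩ := lap_fppd_lt h hne hf
        exact comp k v v' h hne hf (ihn _ h1 _ _ (pd_fppd (h.ne_exit hne)) rfl)
          (ihn _ h2 _ _ (h.fppd_left hne) rfl)

theorem iter_mono (k : ℕ) {v v' : V} (h : G.PD v v') {D₁ D₂ : Distr U} (hD : D₁ ≤ D₂) :
    G.iter Set.univ k v v' D₁ ≤ G.iter Set.univ k v v' D₂ := by
  revert D₁ D₂
  refine iter_induction (G := G) (P := fun k v v' => ∀ {D₁ D₂ : Distr U}, D₁ ≤ D₂ →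
    G.iter Set.univ k v v' D₁ ≤ G.iter Set.univ k v v' D₂) ?_ ?_ ?_ ?_ ?_ k v v' h
  · intros; rfl
  · intro k v D₁ D₂ hD
    rwa [iter_self, iter_self]
  · intro k v v' h hne hf h1 h2 D₁ D₂ hD
    rw [iter_comp h hne hf, iter_comp h hne hf]
    exact h2 (h1 hD)
  · intro k v hv hb D₁ D₂ hD
    rw [iter_basic hv hb, iter_basic hv hb]
    exact Instr.basic_mono hD
  · intro k v B v₁ v₂ hi h1 h2 D₁ D₂ hD
    rw [iter_branch hi, iter_branch hi]
    exact add_le_add (h1 (Distr.select_mono hD)) (h2 (Distr.select_mono hD))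

/-- Continuity of the iterates in the distribution, which lets the limit pass through compositions.
-/
theorem iter_iSup (k : ℕ) {v v' : V} (h : G.PD v v') {D : ℕ → Distr U} (hD : Monotone D) :
    G.iter Set.univ k v v' (fun s => ⨆ n, D n s) =
      fun s => ⨆ n, G.iter Set.univ k v v' (D n) s := by
  revert D
  refine iter_induction (G := G) (P := fun k v v' => G.PD v v' → ∀ {D : ℕ → Distr U},
    Monotone D → G.iter Set.univ k v v' (fun s => ⨆ n, D n s) =
      fun s => ⨆ n, G.iter Set.univ k v v' (D n) s) ?_ ?_ ?_ ?_ ?_ k v v' h h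
  · intro v v' _ D _
    funext s
    simp [iter_zero]
  · intro k v _ D _
    simp only [iter_self]
  · intro k v v' h hne hf h1 h2 _ D hD
    have hv := h.ne_exit hne
    simp only [iter_comp h hne hf]
    rw [h1 (pd_fppd hv) hD]
    exact h2 (h.fppd_left hne) fun m n hmn => iter_mono _ (pd_fppd hv) (hD hmn)
  · intro k v hv hb _ D hD
    simp only [iter_basic hv hb]
    exact Instr.basic_iSup hD
  · intro k v B v₁ v₂ hi h1 h2 _ D hD
    have hpd : ∀ w, G.Edge v w → G.PD w (G.fppd v) := fun w hw => pd_fppd_of_edge hw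
    have hs : ∀ B : BExp U, Monotone fun n => (D n).select B :=
      fun B m n hmn => Distr.select_mono (hD hmn)
    simp only [iter_branch hi, Distr.select_iSup]
    rw [h1 (hpd _ (edge_left hi)) (hs B), h2 (hpd _ (edge_right hi)) (hs B.not)]
    funext s
    exact ENNReal.iSup_add_iSup_of_monotone
      (fun m n hmn => iter_mono _ (hpd _ (edge_left hi)) (hs B hmn) s)
      (fun m n hmn => iter_mono _ (hpd _ (edge_right hi)) (hs B.not hmn) s)

theorem iter_le_succ (k : ℕ) {v v' : V} (h : G.PD v v') (D : Distr U) :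
    G.iter Set.univ k v v' D ≤ G.iter Set.univ (k + 1) v v' D := by
  revert D
  refine iter_induction (G := G) (P := fun k v v' => ∀ D : Distr U,
    G.iter Set.univ k v v' D ≤ G.iter Set.univ (k + 1) v v' D) ?_ ?_ ?_ ?_ ?_ k v v' h
  · intro v v' D s
    simp [iter_zero]
  · intro k v D
    rw [iter_self, iter_self]
  · intro k v v' h hne hf h1 h2 D
    rw [iter_comp h hne hf, iter_comp h hne hf]
    exact (h2 _).trans (iter_mono _ (h.fppd_left hne) (h1 D))
  · intro k v hv hb D
    rw [iter_basic hv hb, iter_basic hv hb]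
  · intro k v B v₁ v₂ hi h1 h2 D
    rw [iter_branch hi, iter_branch hi, level_succ, level_succ]
    exact add_le_add (h1 _) (h2 _)

theorem iter_monotone {v v' : V} (h : G.PD v v') (D : Distr U) :
    Monotone fun k => G.iter Set.univ k v v' D :=
  monotone_nat_of_le_succ fun k => iter_le_succ k h D

/-- Along paths on which no variable in `R` is defined, the weights seen by `R` do not grow. -/
theorem iter_leOn {R : Set U} (k : ℕ) {v v' : V} (h : G.PD v v')
    (hR : G.Along v v' fun u => Disjoint R (G.instr u).defs) (D : Distr U) :
    Distr.LEOn R (G.iter Set.univ k v v' D) D := by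
  revert hR D
  refine iter_induction (G := G) (P := fun k v v' =>
    (G.Along v v' fun u => Disjoint R (G.instr u).defs) → ∀ D : Distr U,
      Distr.LEOn R (G.iter Set.univ k v v' D) D) ?_ ?_ ?_ ?_ ?_ k v v' h
  · intro v v' _ D φ _
    rw [iter_zero, Distr.integ_zero]
    exact zero_le
  · intro k v _ D φ _
    rw [iter_self]
  · intro k v v' h hne hf h1 h2 hR D
    rw [iter_comp h hne hf]
    exact (h2 (hR.fppd_right h hne hf) _).trans (h1 (hR.fppd_left h hne) D)
  · intro k v hv hb hR D φ hφ
    rw [iter_basic hv hb]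
    exact Instr.integ_basic_le hφ (hR.self (ne_fppd hv)) D
  · intro k v B v₁ v₂ hi h1 h2 hR D φ hφ
    have hne := ne_fppd (ne_exit_of_edge (edge_left hi))
    rw [iter_branch hi, Distr.integ_add]
    refine (add_le_add (h1 (hR.of_edge hne (edge_left hi)) _ φ hφ)
      (h2 (hR.of_edge hne (edge_right hi)) _ φ hφ)).trans_eq ?_
    rw [← Distr.integ_add, Distr.select_add_select_not]

/-- A weight that depends on variables not defined along the way can be factored out. -/
theorem iter_mul {R : Set U} {χ : Store U → ℝ≥0∞} (hχ : DependsOn χ R) (k : ℕ) {v v' : V}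
    (h : G.PD v v') (hR : G.Along v v' fun u => Disjoint R (G.instr u).defs)
    (D : Store U → ℝ≥0∞) :
    G.iter Set.univ k v v' (D * χ) = G.iter Set.univ k v v' D * χ := by
  revert hR D
  refine iter_induction (G := G) (P := fun k v v' =>
    (G.Along v v' fun u => Disjoint R (G.instr u).defs) → ∀ D : Store U → ℝ≥0∞,
      G.iter Set.univ k v v' (D * χ) = G.iter Set.univ k v v' D * χ) ?_ ?_ ?_ ?_ ?_ k v v' h
  · intro v v' _ D
    rw [iter_zero, iter_zero, zero_mul]
  · intro k v _ D
    rw [iter_self, iter_self]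
  · intro k v v' h hne hf h1 h2 hR D
    rw [iter_comp h hne hf, iter_comp h hne hf, h1 (hR.fppd_left h hne),
      h2 (hR.fppd_right h hne hf)]
  · intro k v hv hb hR D
    rw [iter_basic hv hb, iter_basic hv hb]
    exact Instr.basic_mul hχ (hR.self (ne_fppd hv)) D
  · intro k v B v₁ v₂ hi h1 h2 hR D
    have hne := ne_fppd (ne_exit_of_edge (edge_left hi))
    rw [iter_branch hi, iter_branch hi, Distr.select_mul, Distr.select_mul,
      h1 (hR.of_edge hne (edge_left hi)), h2 (hR.of_edge hne (edge_right hi)), add_mul]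

/-! ### The least fixed point -/

theorem ω_apply (v v' : V) (D : Distr U) : G.ω v v' D = fun s => ⨆ k, G.iter Set.univ k v v' D s :=
  rfl

theorem iter_le_ω (k : ℕ) (v v' : V) (D : Distr U) : G.iter Set.univ k v v' D ≤ G.ω v v' D :=
  fun s => le_iSup (fun k => G.iter Set.univ k v v' D s) k

theorem integ_ω {v v' : V} (h : G.PD v v') (D : Distr U) (φ : Store U → ℝ≥0∞) :
    (G.ω v v' D).integ φ = ⨆ k, (G.iter Set.univ k v v' D).integ φ :=
  Distr.integ_iSup (iter_monotone h D) φ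

theorem ω_eq_iSup_succ {v v' : V} (h : G.PD v v') (D : Distr U) :
    G.ω v v' D = fun s => ⨆ k, G.iter Set.univ (k + 1) v v' D s := by
  funext s
  exact (Monotone.iSup_nat_add (f := fun k => G.iter Set.univ k v v' D s)
    (fun m n hmn => iter_monotone h D hmn s) 1).symm

theorem ω_self (v : V) (D : Distr U) : G.ω v v D = D := by
  rw [ω_eq_iSup_succ (pd_self v)]
  simp [iter_self]

theorem ω_basic {v : V} (hv : v ≠ G.exit) (hb : ¬ (G.instr v).IsBranch) (D : Distr U) :
    G.ω v (G.fppd v) D = (G.instr v).basic D := by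
  rw [ω_eq_iSup_succ (pd_fppd hv)]
  simp [iter_basic hv hb]

theorem ω_eq_iSup_level {v w : V} (hw : G.Edge v w) (D : Distr U) (s : Store U) :
    G.ω w (G.fppd v) D s = ⨆ k, G.iter Set.univ (G.level v w k) w (G.fppd v) D s := by
  unfold level
  split_ifs
  · rw [ω_eq_iSup_succ (pd_fppd_of_edge hw)]
  · rfl

theorem ω_branch {v v₁ v₂ : V} {B : BExp U} (h : G.instr v = .branch B v₁ v₂) (D : Distr U) :
    G.ω v (G.fppd v) D =
      G.ω v₁ (G.fppd v) (D.select B) + G.ω v₂ (G.fppd v) (D.select B.not) := by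
  have hlev : ∀ w, Monotone (G.level v w) := fun w m n hmn => by
    unfold level
    split_ifs <;> omega
  rw [ω_eq_iSup_succ (pd_fppd (ne_exit_of_edge (edge_left h)))]
  funext s
  rw [Pi.add_apply, ω_eq_iSup_level (edge_left h), ω_eq_iSup_level (edge_right h),
    ENNReal.iSup_add_iSup_of_monotone]
  · exact iSup_congr fun k => by rw [iter_branch h]; rfl
  · exact fun m n hmn => iter_monotone (pd_fppd_of_edge (edge_left h)) _ (hlev _ hmn) s
  · exact fun m n hmn => iter_monotone (pd_fppd_of_edge (edge_right h)) _ (hlev _ hmn) s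

theorem ω_comp {v v' : V} (h : G.PD v v') (hne : v ≠ v') (hf : v' ≠ G.fppd v) (D : Distr U) :
    G.ω v v' D = G.ω (G.fppd v) v' (G.ω v (G.fppd v) D) := by
  have h1 := pd_fppd (h.ne_exit hne)
  have h2 := h.fppd_left hne
  apply le_antisymm
  · rw [ω_eq_iSup_succ h]
    refine fun s => iSup_le fun k => ?_
    rw [iter_comp h hne hf]
    exact (iter_mono _ h2 (iter_le_ω _ _ _ _) s).trans (iter_le_ω _ _ _ _ s)
  · intro s
    refine iSup_le fun k => ?_
    rw [ω_apply v, iter_iSup k h2 (iter_monotone h1 D)]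
    refine iSup_le fun j => ?_
    -- The two limits merge along the diagonal; the successor index is needed to unfold the iterate.
    refine le_trans ?_ (iter_le_ω (max k j + 1) v v' D s)
    rw [iter_comp h hne hf]
    exact (iter_mono _ h2 (iter_monotone h1 D (by omega : j ≤ max k j + 1)) s).trans
      (iter_monotone h2 _ (by omega : k ≤ max k j + 1) s)

theorem ω_leOn {R : Set U} {v v' : V} (h : G.PD v v')
    (hR : G.Along v v' fun u => Disjoint R (G.instr u).defs) (D : Distr U) :
    Distr.LEOn R (G.ω v v' D) D := by
  intro φ hφ
  rw [integ_ω h]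
  exact iSup_le fun k => iter_leOn k h hR D φ hφ

/-- Mass is the integral of a constant, which depends on no variables, so no definition on the way
matters. -/
theorem mass_ω_le {v v' : V} (h : G.PD v v') (D : Distr U) : (G.ω v v' D).mass ≤ D.mass :=
  (ω_leOn (R := ∅) h (fun _ _ _ _ => by simp) D).mass_le

theorem ω_mul {R : Set U} {χ : Store U → ℝ≥0∞} (hχ : DependsOn χ R) {v v' : V}
    (h : G.PD v v') (hR : G.Along v v' fun u => Disjoint R (G.instr u).defs)
    (D : Store U → ℝ≥0∞) : G.ω v v' (D * χ) = G.ω v v' D * χ := by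
  funext s
  simp only [ω_apply, iter_mul hχ _ h hR, Pi.mul_apply, ENNReal.iSup_mul]

end Semantics

end PCFG

/-! ### Independence through test functions -/

namespace Distr

variable {U : Type*}

/-- Independence in terms of test functions. -/
def FunIndependent (D : Distr U) (R₁ R₂ : Set U) : Prop :=
  ∀ φ₁ φ₂ : Store U → ℝ≥0∞, DependsOn φ₁ R₁ → DependsOn φ₂ R₂ → φ₁ ≤ 1 → φ₂ ≤ 1 →
    D.integ (φ₁ * φ₂) * D.mass = D.integ φ₁ * D.integ φ₂

theorem FunIndependent.symm {D : Distr U} {R₁ R₂ : Set U} (h : D.FunIndependent R₁ R₂) :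
    D.FunIndependent R₂ R₁ := fun φ₁ φ₂ h₁ h₂ b₁ b₂ => by
  rw [mul_comm φ₁, h φ₂ φ₁ h₂ h₁ b₂ b₁, mul_comm]

theorem agree_join {R₁ R₂ : Set U} (hd : Disjoint R₁ R₂) (s₁ : R₁ → ℤ) (s₂ : R₂ → ℤ) :
    agree (join s₁ s₂) = agree s₁ * agree s₂ := by
  funext s
  have : (∀ x : ↑(R₁ ∪ R₂), s x = join s₁ s₂ x) ↔
      (∀ x : R₁, s x = s₁ x) ∧ ∀ x : R₂, s x = s₂ x := by
    constructor
    · refine fun h => ⟨fun x => ?_, fun x => ?_⟩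
      · simpa [join] using h ⟨x, Or.inl x.2⟩
      · have hx : x.1 ∉ R₁ := fun hx => Set.disjoint_left.1 hd hx x.2
        simpa [join, hx] using h ⟨x, Or.inr x.2⟩
    · rintro ⟨h₁, h₂⟩ ⟨x, hx⟩
      by_cases hx₁ : x ∈ R₁
      · simpa [join, hx₁] using h₁ ⟨x, hx₁⟩
      · simpa [join, hx₁] using h₂ ⟨x, hx.resolve_left hx₁⟩
  rw [Pi.mul_apply]
  unfold agree
  by_cases h₁ : ∀ x : R₁, s x = s₁ x
  · by_cases h₂ : ∀ x : R₂, s x = s₂ x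
    · rw [if_pos (this.2 ⟨h₁, h₂⟩), if_pos h₁, if_pos h₂, one_mul]
    · rw [if_neg fun h => h₂ (this.1 h).2, if_neg h₂, mul_zero]
  · rw [if_neg fun h => h₁ (this.1 h).1, if_neg h₁, zero_mul]

theorem FunIndependent.independent {D : Distr U} {R₁ R₂ : Set U} (h : D.FunIndependent R₁ R₂)
    (hd : Disjoint R₁ R₂) : D.Independent R₁ R₂ := by
  intro s₁ s₂
  rw [marg_eq_integ, marg_eq_integ, marg_eq_integ, agree_join hd]
  exact h _ _ (agree_dependsOn s₁) (agree_dependsOn s₂) (agree_le_one s₁) (agree_le_one s₂)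

/-- Equal marginals give equal integrals. -/
theorem integ_mul_eq_of_agree {R : Set U} {D χ : Store U → ℝ≥0∞} {a b : ℝ≥0∞}
    (h : ∀ t : R → ℤ, integ D (agree t * χ) * a = integ D (agree t) * b)
    {φ : Store U → ℝ≥0∞} (hφ : DependsOn φ R) :
    integ D (φ * χ) * a = integ D φ * b := by
  obtain ⟨ψ, hψ⟩ := exists_integ_eq_tsum_marg hφ
  rw [mul_comm φ, ← integ_mul, hψ, hψ, ← ENNReal.tsum_mul_right, ← ENNReal.tsum_mul_right]
  refine tsum_congr fun t => ?_
  rw [mul_right_comm, mul_right_comm _ _ b, marg_eq_integ, marg_eq_integ, ← h t, integ_mul,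
    mul_comm χ]

theorem Independent.funIndependent {D : Distr U} {R₁ R₂ : Set U} (h : D.Independent R₁ R₂)
    (hd : Disjoint R₁ R₂) : D.FunIndependent R₁ R₂ := by
  intro φ₁ φ₂ h₁ h₂ _ _
  -- Indicators are replaced by test functions one factor at a time: on `R₁` here, on `R₂`
  -- afterwards.
  have key : ∀ t : R₂ → ℤ, D.integ (agree t * φ₁) * D.mass = D.integ (agree t) * D.integ φ₁ := by
    intro t
    rw [mul_comm (agree t), integ_mul_eq_of_agree (b := D.integ (agree t)) (fun s => ?_) h₁,
      mul_comm]
    have := h s t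
    rwa [marg_eq_integ, marg_eq_integ, marg_eq_integ, agree_join hd] at this
  rw [mul_comm φ₁, integ_mul_eq_of_agree key h₂, mul_comm]

end Distr

namespace PCFG

/-! ### Slicing pairs -/

section Slicing

variable {V U : Type*} [Finite V] {G : PCFG V U} {Q Q₀ : Set V}

/-- `ω` preserves the mass on the way through nodes outside `Q` where every observe node and every
cycle-inducing node that changes the mass is in `Q`. -/
theorem mass_ω_eq (hobs : ∀ v, (G.instr v).IsObserve → v ∈ Q)
    (hcyc : ∀ v, G.CycleInducing v → v ∈ Q ∨ Distr.SumPreserving (G.ω v (G.fppd v)))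
    {v v' : V} (h : G.PD v v') (hQ : G.Along v v' (· ∉ Q)) {D : Distr U} (hD : D.mass ≠ ∞) :
    (G.ω v v' D).mass = D.mass := by
  induction hn : G.LAP v v' using Nat.strong_induction_on generalizing v v' D with
  | _ n ih =>
    subst hn
    by_cases hne : v = v'
    · subst hne
      rw [ω_self]
    have hv := h.ne_exit hne
    by_cases hf : v' = G.fppd v
    · subst hf
      have hvQ := hQ.self hne
      by_cases hc : G.CycleInducing v
      · exact (hcyc v hc).resolve_left hvQ D hD
      by_cases hb : (G.instr v).IsBranch
      · cases hi : G.instr v with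
        | branch B v₁ v₂ =>
          have key : ∀ w, G.Edge v w → ∀ D' : Distr U, D'.mass ≠ ∞ →
              (G.ω w (G.fppd v) D').mass = D'.mass := fun w hw D' hD' =>
            -- Not being cycle-inducing means exactly that `LAP` drops at every successor.
            ih _ (not_le.1 fun hle => hc ⟨w, hw, hle⟩) (pd_fppd_of_edge hw) (hQ.of_edge hne hw)
              hD' rfl
          have hsum : (D.select B).mass + (D.select B.not).mass = D.mass := by
            simp only [Distr.mass_eq_integ]
            rw [← Distr.integ_add, Distr.select_add_select_not]
          have hfin := ENNReal.add_ne_top.1 (hsum ▸ hD)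
          rw [ω_branch hi, ← hsum, ← key _ (edge_left hi) _ hfin.1,
            ← key _ (edge_right hi) _ hfin.2]
          simp only [Distr.mass_eq_integ, Distr.integ_add]
        | _ => rw [hi] at hb; exact hb.elim
      · rw [ω_basic hv hb]
        exact Instr.mass_basic (fun ho => hvQ (hobs v ho)) D
    · obtain ⟨h1, h2⟩ := lap_fppd_lt h hne hf
      have e := ih _ h1 (pd_fppd hv) (hQ.fppd_left h hne) hD rfl
      rw [ω_comp h hne hf, ih _ h2 (h.fppd_left hne) (hQ.fppd_right h hne hf) (e ▸ hD) rfl, e]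

variable (G Q Q₀) in
/-- The part of the definition of a slicing pair that is symmetric in `Q` and `Q₀`. -/
structure SymmSlicingPair : Prop where
  weak : G.WeakSliceSet Q
  weak₀ : G.WeakSliceSet Q₀
  disjoint : Disjoint Q Q₀
  observe_mem : ∀ v, (G.instr v).IsObserve → v ∈ Q ∪ Q₀
  cycleInducing : ∀ v, G.CycleInducing v →
    v ∈ Q ∪ Q₀ ∨ Distr.SumPreserving (G.ω v (G.fppd v))

theorem SlicingPair.symmSlicingPair (h : G.SlicingPair Q Q₀) : G.SymmSlicingPair Q Q₀ :=
  ⟨h.weak, h.weak₀, h.disjoint, h.observe_mem, h.cycleInducing⟩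

namespace SymmSlicingPair

theorem symm (h : G.SymmSlicingPair Q Q₀) : G.SymmSlicingPair Q₀ Q :=
  ⟨h.weak₀, h.weak, h.disjoint.symm, fun v hv => (h.observe_mem v hv).symm,
    fun v hv => (h.cycleInducing v hv).imp_left Or.symm⟩

theorem rv_fppd_eq (h : G.SymmSlicingPair Q Q₀) {v : V} (hv : v ≠ G.exit) (hvQ : v ∉ Q) :
    G.rv Q (G.fppd v) = G.rv Q v :=
  h.weak.closed.rv_eq (pd_fppd hv) (h.weak.along hv hvQ)

/-- On the relevant variables, the iterate of `D₁` is below `D₁`, which is below `D₂`, which agrees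
with its image under `ω` since the mass is kept. Only the limit keeps the mass, hence `ω` and not an
iterate on the right. -/
theorem iter_leOn_ω_of_notMem (h : G.SymmSlicingPair Q Q₀) {v : V} (hv : v ≠ G.exit)
    (hvQ : v ∉ Q) (hQ₀ : G.Along v (G.fppd v) (· ∉ Q₀)) (k : ℕ) {D₁ D₂ : Distr U}
    (hD : D₂.mass ≠ ∞) (hle : Distr.LEOn (G.rv Q v) D₁ D₂) :
    Distr.LEOn (G.rv Q (G.fppd v)) (G.iter Set.univ k v (G.fppd v) D₁)
      (G.ω v (G.fppd v) D₂) := by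
  have hpd := pd_fppd hv
  have hQ := h.weak.along hv hvQ
  have hdef := h.weak.closed.along_notMem_defs hpd hQ
  -- The way avoids the union `Q ∪ Q₀`, to which mass preservation is applied.
  have hm := mass_ω_eq h.observe_mem h.cycleInducing hpd
    (fun u π hπ hn hu => hu.elim (hQ u π hπ hn) (hQ₀ u π hπ hn)) hD
  rw [← h.rv_fppd_eq hv hvQ] at hle
  exact ((iter_leOn k hpd hdef D₁).trans hle).trans
    ((ω_leOn hpd hdef D₂).symm_of_mass_eq hm (hm ▸ hD))

/-- Away from `Q₀`, the weights seen by the `Q`-relevant variables at `v'` are determined,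
monotonically, by the weights seen by the `Q`-relevant variables at `v`. -/
theorem iter_leOn_ω (h : G.SymmSlicingPair Q Q₀) (k : ℕ) {v v' : V} (hpd : G.PD v v')
    (hQ₀ : G.Along v v' (· ∉ Q₀)) {D₁ D₂ : Distr U} (hD : D₂.mass ≠ ∞)
    (hle : Distr.LEOn (G.rv Q v) D₁ D₂) :
    Distr.LEOn (G.rv Q v') (G.iter Set.univ k v v' D₁) (G.ω v v' D₂) := by
  revert hQ₀ D₁ D₂
  refine iter_induction (G := G) (P := fun k v v' => G.Along v v' (· ∉ Q₀) →
    ∀ {D₁ D₂ : Distr U}, D₂.mass ≠ ∞ → Distr.LEOn (G.rv Q v) D₁ D₂ →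
    Distr.LEOn (G.rv Q v') (G.iter Set.univ k v v' D₁) (G.ω v v' D₂))
    ?_ ?_ ?_ ?_ ?_ k v v' hpd
  · intro v v' _ D₁ D₂ _ _ φ _
    rw [iter_zero, Distr.integ_zero]
    exact zero_le
  · intro k v _ D₁ D₂ _ hle
    rwa [iter_self, ω_self]
  · intro k v v' hpd hne hf h1 h2 hQ₀ D₁ D₂ hD hle
    rw [iter_comp hpd hne hf, ω_comp hpd hne hf]
    exact h2 (hQ₀.fppd_right hpd hne hf)
      (((mass_ω_le (pd_fppd (hpd.ne_exit hne)) D₂).trans_lt hD.lt_top).ne)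
      (h1 (hQ₀.fppd_left hpd hne) hD hle)
  · intro k v hv hb hQ₀ D₁ D₂ hD hle
    -- A node of `Q` reads only relevant variables, so the comparison can be pulled back through it.
    by_cases hvQ : v ∈ Q
    · rw [iter_basic hv hb, ω_basic hv hb]
      exact basic_leOn hv hb hvQ hle
    · exact h.iter_leOn_ω_of_notMem hv hvQ hQ₀ _ hD hle
  · intro k v B v₁ v₂ hi h1 h2 hQ₀ D₁ D₂ hD hle
    have hv := ne_exit_of_edge (edge_left hi)
    by_cases hvQ : v ∈ Q
    · rw [iter_branch hi, ω_branch hi]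
      have hb : (G.instr v).IsBranch := by rw [hi]; trivial
      have hu : B.fv ⊆ G.rv Q v := by
        have := uses_subset_rv (G := G) hvQ
        rwa [hi] at this
      have hfin : ∀ B : BExp U, (D₂.select B).mass ≠ ∞ := fun B => by
        refine (lt_of_le_of_lt ?_ hD.lt_top).ne
        rw [Distr.mass_eq_integ, Distr.mass_eq_integ,
          ← congrArg (Distr.integ · 1) (Distr.select_add_select_not B D₂), Distr.integ_add]
        exact le_self_add
      intro φ hφ
      rw [Distr.integ_add, Distr.integ_add]
      exact add_le_add
        (h1 (hQ₀.of_edge (ne_fppd hv) (edge_left hi)) (hfin B)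
          (hle.select (rv_subset_of_isBranch hb (edge_left hi)) hu) φ hφ)
        (h2 (hQ₀.of_edge (ne_fppd hv) (edge_right hi)) (hfin B.not)
          (hle.select (rv_subset_of_isBranch hb (edge_right hi)) hu) φ hφ)
    · exact h.iter_leOn_ω_of_notMem hv hvQ hQ₀ _ hD hle

theorem ω_leOn_ω (h : G.SymmSlicingPair Q Q₀) {v v' : V} (hpd : G.PD v v')
    (hQ₀ : G.Along v v' (· ∉ Q₀)) {D₁ D₂ : Distr U} (hD : D₂.mass ≠ ∞)
    (hle : Distr.LEOn (G.rv Q v) D₁ D₂) :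
    Distr.LEOn (G.rv Q v') (G.ω v v' D₁) (G.ω v v' D₂) := by
  intro φ hφ
  rw [integ_ω hpd]
  exact iSup_le fun k => h.iter_leOn_ω k hpd hQ₀ hD hle φ hφ

/-- Independence is an equality of `Q`-marginals for two reweighted versions of `D`. The weights
involve only `Q₀`-relevant variables, which the way leaves alone, so they can be applied before or
after `ω`. -/
theorem integ_ω_mul (h : G.SymmSlicingPair Q Q₀) {v v' : V} (hpd : G.PD v v')
    (hQ₀ : G.Along v v' (· ∉ Q₀)) {D : Store U → ℝ≥0∞} (hD : Distr.mass D ≠ ∞)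
    (hind : Distr.FunIndependent D (G.rv Q v) (G.rv Q₀ v)) {φ₁ φ₂ : Store U → ℝ≥0∞}
    (h₁ : DependsOn φ₁ (G.rv Q v')) (h₂ : DependsOn φ₂ (G.rv Q₀ v)) (b₂ : φ₂ ≤ 1) :
    (G.ω v v' D).integ (φ₁ * φ₂) * Distr.mass D =
      (G.ω v v' D).integ φ₁ * Distr.integ D φ₂ := by
  have hdef := h.weak₀.closed.along_notMem_defs hpd hQ₀
  rw [h.weak₀.closed.rv_eq hpd hQ₀] at hdef
  have hfin := (Distr.integ_le_mass D b₂).trans_lt hD.lt_top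
  -- The factors `mass D` and `∫ φ₂ dD` state independence without division.
  set Da : Store U → ℝ≥0∞ := D * ((fun _ => Distr.mass D) * φ₂)
  set Db : Store U → ℝ≥0∞ := D * fun _ => Distr.integ D φ₂
  have ia : ∀ φ, Distr.integ Da φ = Distr.integ D (φ * φ₂) * Distr.mass D := fun φ => by
    rw [Distr.integ_mul, mul_assoc, Distr.integ_const_mul, mul_comm, mul_comm φ]
  have ib : ∀ φ, Distr.integ Db φ = Distr.integ D φ * Distr.integ D φ₂ := fun φ => by
    rw [Distr.integ_mul, Distr.integ_const_mul, mul_comm]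
  have heq : ∀ t : G.rv Q v → ℤ, Distr.marg Da t = Distr.marg Db t := fun t => by
    rw [Distr.marg_eq_integ, Distr.marg_eq_integ, ia, ib]
    exact hind _ _ (Distr.agree_dependsOn t) h₂ (Distr.agree_le_one t) b₂
  have ma : Distr.mass Da ≠ ∞ := by
    rw [Distr.mass_eq_integ, ia, one_mul]
    exact ENNReal.mul_ne_top hfin.ne hD
  have mb : Distr.mass Db ≠ ∞ := by
    rw [Distr.mass_eq_integ, ib, ← Distr.mass_eq_integ]
    exact ENNReal.mul_ne_top hD hfin.ne
  have key : (G.ω v v' Da).integ φ₁ = (G.ω v v' Db).integ φ₁ :=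
    le_antisymm
      (h.ω_leOn_ω hpd hQ₀ mb (Distr.leOn_of_marg_le fun t => (heq t).le) φ₁ h₁)
      (h.ω_leOn_ω hpd hQ₀ ma (Distr.leOn_of_marg_le fun t => (heq t).ge) φ₁ h₁)
  have hχ : DependsOn ((fun _ => Distr.mass D) * φ₂) (G.rv Q₀ v) := fun s s' hs => by
    rw [Pi.mul_apply, Pi.mul_apply, h₂ hs]
  rw [ω_mul hχ hpd hdef, ω_mul (R := G.rv Q₀ v) (fun _ _ _ => rfl) hpd hdef, Distr.integ_mul,
    Distr.integ_mul, mul_assoc, Distr.integ_const_mul, Distr.integ_const_mul] at key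
  rw [mul_comm φ₁, mul_comm, key, mul_comm]

theorem integ_ω_eq (h : G.SymmSlicingPair Q Q₀) {v v' : V} (hpd : G.PD v v')
    (hQ₀ : G.Along v v' (· ∉ Q₀)) {D : Distr U} (hD : D.mass ≠ ∞)
    (hind : D.FunIndependent (G.rv Q v) (G.rv Q₀ v)) {φ : Store U → ℝ≥0∞}
    (hφ : DependsOn φ (G.rv Q₀ v)) (b : φ ≤ 1) :
    D.integ φ * (G.ω v v' D).mass = (G.ω v v' D).integ φ * D.mass := by
  have := h.integ_ω_mul hpd hQ₀ hD hind (φ₁ := 1) (fun _ _ _ => rfl) hφ b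
  rw [one_mul, ← Distr.mass_eq_integ] at this
  rw [this, mul_comm]

theorem funIndependent_ω_of_along (h : G.SymmSlicingPair Q Q₀) {v v' : V} (hpd : G.PD v v')
    (hQ₀ : G.Along v v' (· ∉ Q₀)) {D : Distr U} (hD : D.mass ≠ ∞)
    (hind : D.FunIndependent (G.rv Q v) (G.rv Q₀ v)) :
    (G.ω v v' D).FunIndependent (G.rv Q v') (G.rv Q₀ v') := by
  rw [h.weak₀.closed.rv_eq hpd hQ₀]
  intro φ₁ φ₂ h₁ h₂ b₁ b₂
  have hle := mass_ω_le hpd D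
  by_cases hz : D.mass = 0
  · have hz' : (G.ω v v' D).mass = 0 := by simpa [hz] using hle
    have hz₁ : (G.ω v v' D).integ φ₁ = 0 := by
      simpa [hz'] using (G.ω v v' D).integ_le_mass b₁
    rw [hz', hz₁, mul_zero, zero_mul]
  -- After multiplication by `mass D`, nonzero and finite, `∫ φ₂ dD` is traded for the integral of
  -- `φ₂` over the image under `ω`.
  · rw [← ENNReal.mul_left_inj hz hD, mul_right_comm, h.integ_ω_mul hpd hQ₀ hD hind h₁ h₂ b₂,
      mul_assoc, h.integ_ω_eq hpd hQ₀ hD hind h₂ b₂, mul_assoc]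

/-- Independence is carried along the chain of first proper postdominators. Each link starts at a
node outside `Q` or outside `Q₀`, hence avoids that set altogether. -/
theorem funIndependent_ω (h : G.SymmSlicingPair Q Q₀) {v v' : V} (hpd : G.PD v v')
    {D : Distr U} (hD : D.mass ≠ ∞) (hind : D.FunIndependent (G.rv Q v) (G.rv Q₀ v)) :
    (G.ω v v' D).FunIndependent (G.rv Q v') (G.rv Q₀ v') := by
  induction hn : G.LAP v v' using Nat.strong_induction_on generalizing v v' D with
  | _ n ih =>
    subst hn
    by_cases hne : v = v'
    · subst hne
      rwa [ω_self]
    have hv := hpd.ne_exit hne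
    by_cases hf : v' = G.fppd v
    · subst hf
      by_cases hvQ : v ∈ Q
      · have hvQ₀ : v ∉ Q₀ := fun hm => Set.disjoint_left.1 h.disjoint hvQ hm
        exact h.funIndependent_ω_of_along hpd (h.weak₀.along hv hvQ₀) hD hind
      · exact (h.symm.funIndependent_ω_of_along hpd (h.weak.along hv hvQ) hD hind.symm).symm
    · obtain ⟨h1, h2⟩ := lap_fppd_lt hpd hne hf
      rw [ω_comp hpd hne hf]
      exact ih _ h2 (hpd.fppd_left hne)
        (((mass_ω_le (pd_fppd hv) D).trans_lt hD.lt_top).ne)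
        (ih _ h1 (pd_fppd hv) hD hind rfl) rfl

end SymmSlicingPair

end Slicing

end PCFG

theorem mainTheorem2 {V U : Type*} [Finite V] [Finite U] (G : PCFG V U) (Q Q₀ : Set V)
    (hQ : G.SlicingPair Q Q₀) (v v' : V) (hv : G.PD v v') (D : Distr U) (hD : D.mass ≠ ∞)
    (hind : D.Independent (G.rv Q v) (G.rv Q₀ v)) :
    (Disjoint (G.rv Q v') (G.rv Q₀ v') ∧
      (G.ω v v' D).Independent (G.rv Q v') (G.rv Q₀ v')) ∧
    (G.StaysOutside Q v v' → G.rv Q v' = G.rv Q v ∧ ∀ s : G.rv Q v → ℤ,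
      D.marg s * (G.ω v v' D).mass = (G.ω v v' D).marg s * D.mass) ∧
    (G.StaysOutside Q₀ v v' → G.rv Q₀ v' = G.rv Q₀ v ∧ ∀ s₀ : G.rv Q₀ v → ℤ,
      D.marg s₀ * (G.ω v v' D).mass = (G.ω v v' D).marg s₀ * D.mass) := by
  have h := hQ.symmSlicingPair
  have hdis := PCFG.disjoint_rv hQ.weak.closed hQ.weak₀.closed hQ.disjoint
  have hfun := hind.funIndependent (hdis v)
  refine ⟨⟨hdis v', (h.funIndependent_ω hv hD hfun).independent (hdis v')⟩, fun hs => ?_,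
    fun hs => ?_⟩
  · refine ⟨hQ.weak.closed.rv_eq hv (hs.along hv), fun s => ?_⟩
    rw [Distr.marg_eq_integ, Distr.marg_eq_integ]
    -- The second claim is the third with the roles of the slice sets exchanged; that the end node
    -- is in `Q` plays no role in it.
    exact h.symm.integ_ω_eq hv (hs.along hv) hD hfun.symm (Distr.agree_dependsOn s)
      (Distr.agree_le_one s)
  · refine ⟨hQ.weak₀.closed.rv_eq hv (hs.along hv), fun s => ?_⟩
    rw [Distr.marg_eq_integ, Distr.marg_eq_integ]
    exact h.integ_ω_eq hv (hs.along hv) hD hfun (Distr.agree_dependsOn s)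
      (Distr.agree_le_one s)
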